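/- Let $V$ be a valuation domain (of arbitrary rank, possibly a field) with quotient field $K$ and associated valuation $v$ with value group $\Gamma_v$, let $\overline K$ be an algebraic closure of $K$, and let $U$ be a valuation domain of $\overline K$ with $U\cap K=V$, with associated valuation $u$ extending $v$. Let $\Gamma_{\overline v}=\Gamma_v\otimes_{\mathbb Z}\mathbb Q$ be the divisible hull of $\Gamma_v$, realised in the (divisible, torsion-free) value group of $u$ as the set of all $\gamma$ with $n\gamma\in\Gamma_v$ for some integer $n\ge 1$. For $(\alpha,\delta)\in\overline K\times\Gamma_{\overline v}$ let $B_u(\alpha,\delta)=\{x\in\overline K\mid u(x-\alpha)\ge\delta\}$, and let $U_{\alpha,\delta}$ be the valuation domain of $\overline K(X)$ associated with the monomial valuation $u_{\alpha,\delta}$, which is determined on polynomials by $$u_{\alpha,\delta}\Bigl(\sum_{i=0}^n a_i(X-\alpha)^i\Bigr)=\min_{0\le i\le n}\bigl(u(a_i)+i\delta\bigr).$$ Let $\mathcal B_u$ be the set of all the balls $B_u(\alpha,\delta)$ with $(\alpha,\delta)\in\overline K\times\Gamma_{\overline v}$. The decomposition group $\mathcal D(U)=\{\sigma\in\mathrm{Gal}(\overline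 K/K)\mid\sigma(U)=U\}$ (where $\mathrm{Gal}(\overline K/K)$ is the group of all $K$-automorphisms of $\overline K$) acts on $\mathcal B_u$ by $(\sigma,B)\mapsto\sigma(B)$; let $\mathcal B_u/\mathcal D(U)$ be the set of orbits and $[B]$ the orbit of $B$. Let $\mathcal W_{\mathrm{rt}}$ be the set of residually transcendental extensions of $V$ to $K(X)$, i.e. of the valuation domains $W$ of $K(X)$ with $W\cap K=V$ such that the residue field of $W$ is a transcendental extension of the residue field of $V$. Then the map $$\Theta:\mathcal B_u/\mathcal D(U)\to\mathcal W_{\mathrm{rt}},\qquad [B_u(\alpha,\delta)]\mapsto U_{\alpha,\delta}\cap K(X)$$ is well defined and bijective. -/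

import Mathlib

open scoped Polynomial Pointwise nonZeroDivisors

namespace RTExt

universe u w

/-! Valuations are written multiplicatively, as in Mathlib: `v x ≤ 1` cuts out the valuation ring,
a large additive value is a small multiplicative one, an additive `δ` becomes a nonzero `ρ`,
`v(x) ≥ δ` becomes `v x ≤ ρ`, and an infimum becomes a supremum. -/

section Monomial

variable {L Γ : Type*} [Field L] [LinearOrderedCommGroupWithZero Γ]

/-- For `f = ∑ aᵢ Xⁱ` the value `supᵢ v(aᵢ) ρⁱ` (equal to `0` for `f = 0`). -/
noncomputable def gaussFun (v : Valuation L Γ) (ρ : Γ) (f : L[X]) : Γ :=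
  f.support.sup fun i => v (f.coeff i) * ρ ^ i

@[simp]
theorem gaussFun_zero (v : Valuation L Γ) (ρ : Γ) : gaussFun v ρ (0 : L[X]) = 0 := by
  rw [gaussFun, Polynomial.support_zero, Finset.sup_empty, bot_eq_zero]

theorem le_gaussFun (v : Valuation L Γ) (ρ : Γ) (f : L[X]) (i : ℕ) :
    v (f.coeff i) * ρ ^ i ≤ gaussFun v ρ f := by
  by_cases h : i ∈ f.support
  · exact Finset.le_sup (f := fun i => v (f.coeff i) * ρ ^ i) h
  · rw [Polynomial.notMem_support_iff.mp h]
    simp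

theorem gaussFun_le {v : Valuation L Γ} {ρ : Γ} {f : L[X]} {c : Γ}
    (h : ∀ i, v (f.coeff i) * ρ ^ i ≤ c) : gaussFun v ρ f ≤ c :=
  Finset.sup_le fun i _ => h i

theorem gaussFun_ne_zero (v : Valuation L Γ) {ρ : Γ} (hρ : ρ ≠ 0) {f : L[X]} (hf : f ≠ 0) :
    gaussFun v ρ f ≠ 0 := by
  intro h
  have h1 := le_gaussFun v ρ f f.natDegree
  rw [h, le_zero_iff] at h1
  simp [hρ, hf] at h1

/-- The supremum is attained, and there is a smallest index at which it is attained. -/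
theorem exists_min_index (v : Valuation L Γ) (ρ : Γ) {f : L[X]} (hf : f ≠ 0) :
    ∃ i, v (f.coeff i) * ρ ^ i = gaussFun v ρ f ∧
      ∀ j < i, v (f.coeff j) * ρ ^ j < gaussFun v ρ f := by
  classical
  have hex : ∃ i, v (f.coeff i) * ρ ^ i = gaussFun v ρ f := by
    obtain ⟨i, -, hi⟩ := Finset.exists_mem_eq_sup f.support
      (Polynomial.support_nonempty.mpr hf) (fun i => v (f.coeff i) * ρ ^ i)
    exact ⟨i, hi.symm⟩
  exact ⟨Nat.find hex, Nat.find_spec hex, fun j hj =>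
    lt_of_le_of_ne (le_gaussFun v ρ f j) (Nat.find_min hex hj)⟩

theorem gaussFun_mul_le (v : Valuation L Γ) (ρ : Γ) (f g : L[X]) :
    gaussFun v ρ (f * g) ≤ gaussFun v ρ f * gaussFun v ρ g := by
  refine Finset.sup_le fun n _ => ?_
  rw [Polynomial.coeff_mul]
  have key : ∀ p ∈ Finset.HasAntidiagonal.antidiagonal n,
      v (f.coeff p.1 * g.coeff p.2) * ρ ^ n ≤ gaussFun v ρ f * gaussFun v ρ g := by
    rintro ⟨i, j⟩ hp
    obtain rfl : i + j = n := by simpa using hp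
    calc v (f.coeff i * g.coeff j) * ρ ^ (i + j)
        = (v (f.coeff i) * ρ ^ i) * (v (g.coeff j) * ρ ^ j) := by
          rw [map_mul, pow_add, mul_mul_mul_comm]
      _ ≤ _ := mul_le_mul' (le_gaussFun v ρ f i) (le_gaussFun v ρ g j)
  by_cases hρ : ρ ^ n = 0
  · simp [hρ]
  · rw [← le_div_iff₀ (zero_lt_iff.mpr hρ)]
    refine v.map_sum_le fun p hp => ?_
    rw [le_div_iff₀ (zero_lt_iff.mpr hρ)]
    exact key p hp

theorem gaussFun_mul (v : Valuation L Γ) {ρ : Γ} (hρ : ρ ≠ 0) (f g : L[X]) :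
    gaussFun v ρ (f * g) = gaussFun v ρ f * gaussFun v ρ g := by
  classical
  rcases eq_or_ne f 0 with rfl | hf
  · simp
  rcases eq_or_ne g 0 with rfl | hg
  · simp
  refine le_antisymm (gaussFun_mul_le v ρ f g) ?_
  obtain ⟨i, hi, hi'⟩ := exists_min_index v ρ hf
  obtain ⟨j, hj, hj'⟩ := exists_min_index v ρ hg
  have hF := zero_lt_iff.mpr (gaussFun_ne_zero v hρ hf)
  have hG := zero_lt_iff.mpr (gaussFun_ne_zero v hρ hg)
  have hn : 0 < ρ ^ (i + j) := zero_lt_iff.mpr (pow_ne_zero _ hρ)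
  have hsplit : ∀ a b : ℕ, v (f.coeff a * g.coeff b) * ρ ^ (a + b)
      = (v (f.coeff a) * ρ ^ a) * (v (g.coeff b) * ρ ^ b) := fun a b => by
    rw [map_mul, pow_add, mul_mul_mul_comm]
  have hmain : v (f.coeff i * g.coeff j) * ρ ^ (i + j) = gaussFun v ρ f * gaussFun v ρ g := by
    rw [hsplit, hi, hj]
  have hmem : (i, j) ∈ Finset.HasAntidiagonal.antidiagonal (i + j) := by simp
  have hcoeff : v ((f * g).coeff (i + j)) = v (f.coeff i * g.coeff j) := by
    rw [Polynomial.coeff_mul, ← Finset.add_sum_erase _ _ hmem]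
    refine v.map_add_eq_of_lt_left ?_
    have hpos : v (f.coeff i * g.coeff j) ≠ 0 := by
      intro h0
      rw [h0, zero_mul] at hmain
      exact (mul_pos hF hG).ne hmain
    refine v.map_sum_lt hpos ?_
    rintro ⟨a, b⟩ hab
    obtain ⟨hne, hab⟩ := Finset.mem_erase.mp hab
    have hab : a + b = i + j := by simpa using hab
    rw [← mul_lt_mul_iff_left₀ hn, hmain, ← hab]
    simp only
    rw [hsplit]
    rcases lt_trichotomy a i with h | h | h
    · exact (mul_le_mul_right (le_gaussFun v ρ g b) _).trans_lt
        ((mul_lt_mul_iff_left₀ hG).mpr (hi' a h))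
    · exact absurd (Prod.ext h (by simp only; omega)) hne
    · exact mul_lt_mul' (le_gaussFun v ρ f a) (hj' b (by omega)) zero_le hF
  calc gaussFun v ρ f * gaussFun v ρ g = v ((f * g).coeff (i + j)) * ρ ^ (i + j) := by
        rw [hcoeff, hmain]
    _ ≤ _ := le_gaussFun v ρ (f * g) (i + j)

/-- The valuation `∑ aᵢ Xⁱ ↦ supᵢ v(aᵢ) ρⁱ` on polynomials. -/
noncomputable def gaussValuation (v : Valuation L Γ) (ρ : Γˣ) : Valuation L[X] Γ where
  toFun := gaussFun v (ρ : Γ)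
  map_zero' := gaussFun_zero v ρ
  map_one' := by
    rw [gaussFun, ← Polynomial.C_1, Polynomial.support_C one_ne_zero]
    simp
  map_mul' := gaussFun_mul v ρ.ne_zero
  map_add_le_max' f g := by
    refine gaussFun_le fun i => ?_
    rw [Polynomial.coeff_add]
    calc v (f.coeff i + g.coeff i) * (ρ : Γ) ^ i
        ≤ max (v (f.coeff i)) (v (g.coeff i)) * (ρ : Γ) ^ i :=
          mul_le_mul_left (v.map_add _ _) _
      _ = max (v (f.coeff i) * (ρ : Γ) ^ i) (v (g.coeff i) * (ρ : Γ) ^ i) :=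
          (max_mul_mul_right _ _ _).symm
      _ ≤ _ := max_le_max (le_gaussFun v _ f i) (le_gaussFun v _ g i)

/-- The monomial valuation on polynomials: if `f = ∑ aᵢ (X - α)ⁱ`, i.e. if `∑ aᵢ Xⁱ` is the
Taylor expansion `f(X + α)`, its value is `supᵢ v(aᵢ) ρⁱ`. -/
noncomputable def monomialValuation (v : Valuation L Γ) (α : L) (ρ : Γˣ) : Valuation L[X] Γ :=
  (gaussValuation v ρ).comap (Polynomial.taylorAlgHom α : L[X] →+* L[X])

theorem monomialValuation_apply (v : Valuation L Γ) (α : L) (ρ : Γˣ) (f : L[X]) :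
    monomialValuation v α ρ f = (Polynomial.taylor α f).support.sup
      fun i => v ((Polynomial.taylor α f).coeff i) * (ρ : Γ) ^ i := rfl

theorem nonZeroDivisors_le_supp (v : Valuation L Γ) (α : L) (ρ : Γˣ) :
    L[X]⁰ ≤ (monomialValuation v α ρ).supp.primeCompl := by
  intro f hf h
  refine gaussFun_ne_zero v ρ.ne_zero ?_ ((Valuation.mem_supp_iff _ _).mp h)
  intro h0
  exact nonZeroDivisors.ne_zero hf (Polynomial.taylor_injective α (by simpa using h0))

/-- The monomial valuation on the field of rational functions. -/
noncomputable def monomialValuationRat (v : Valuation L Γ) (α : L) (ρ : Γˣ) :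
    Valuation (RatFunc L) Γ :=
  (monomialValuation v α ρ).extendToLocalization (nonZeroDivisors_le_supp v α ρ) (RatFunc L)

/-- The valuation ring `U_{α,ρ}` of the monomial valuation, for the valuation of a valuation
ring `U` of `L`. -/
noncomputable def monomialRing (U : ValuationSubring L) (α : L) (ρ : U.ValueGroupˣ) :
    ValuationSubring (RatFunc L) :=
  (monomialValuationRat U.valuation α ρ).valuationSubring

end Monomial

section Extensions

variable (K : Type u) {L : Type w} [Field K] [Field L] [Algebra K L]

/-- The embedding of `K(X)` into `L(X)` that is `K → L` on constants and fixes `X`. -/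
noncomputable def ratFuncMap (K : Type u) (L : Type w) [Field K] [Field L] [Algebra K L] :
    RatFunc K →+* RatFunc L :=
  RatFunc.mapRingHom (Polynomial.mapRingHom (algebraMap K L))
    (nonZeroDivisors_le_comap_nonZeroDivisors_of_injective _
      (Polynomial.map_injective _ (algebraMap K L).injective))

/-- The divisible hull of the value group of `V = U ∩ K`, realised inside the value group of `U`:
the elements that have a positive power in the value group of `V`. When `L` is algebraically closed,
the value group of `U` is divisible and torsion-free, so this is the divisible hull
(see `exists_pow_eq_of_mem_hull` and `valuation_mem_hull`). -/
def hull (U : ValuationSubring L) : Subgroup U.ValueGroupˣ where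
  carrier := {ρ | ∃ n : ℕ, 0 < n ∧ ∃ a : K, (ρ : U.ValueGroup) ^ n = U.valuation (algebraMap K L a)}
  one_mem' := ⟨1, one_pos, 1, by simp⟩
  mul_mem' := by
    rintro ρ τ ⟨n, hn, a, ha⟩ ⟨m, hm, b, hb⟩
    refine ⟨n * m, Nat.mul_pos hn hm, a ^ m * b ^ n, ?_⟩
    rw [map_mul, map_mul, map_pow, map_pow, map_pow, map_pow, ← ha, ← hb, Units.val_mul, mul_pow,
      ← pow_mul, ← pow_mul, mul_comm m n]
  inv_mem' := by
    rintro ρ ⟨n, hn, a, ha⟩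
    exact ⟨n, hn, a⁻¹, by rw [map_inv₀, map_inv₀, ← ha, Units.val_inv_eq_inv_val, inv_pow]⟩

theorem mem_hull {U : ValuationSubring L} {ρ : U.ValueGroupˣ} :
    ρ ∈ hull K U ↔
      ∃ n : ℕ, 0 < n ∧ ∃ a : K, (ρ : U.ValueGroup) ^ n = U.valuation (algebraMap K L a) :=
  Iff.rfl

/-- The hull contains the value group of `V`. -/
theorem valuation_mem_hull (U : ValuationSubring L) {a : K} (ha : a ≠ 0) :
    Units.mk0 (U.valuation (algebraMap K L a)) (by simpa using ha) ∈ hull K U :=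
  ⟨1, one_pos, a, by simp⟩

/-- The hull is divisible. -/
theorem exists_pow_eq_of_mem_hull [IsAlgClosed L] (U : ValuationSubring L) (ρ : U.ValueGroupˣ)
    (hρ : ρ ∈ hull K U) (n : ℕ) (hn : 0 < n) : ∃ τ ∈ hull K U, τ ^ n = ρ := by
  obtain ⟨c, hc⟩ := U.valuation_surjective (ρ : U.ValueGroup)
  obtain ⟨d, hd⟩ := IsAlgClosed.exists_pow_nat_eq c hn
  have hd' : U.valuation d ^ n = (ρ : U.ValueGroup) := by rw [← map_pow, hd, hc]
  have hd0 : U.valuation d ≠ 0 := fun h => ρ.ne_zero (by rw [← hd', h, zero_pow hn.ne'])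
  obtain ⟨m, hm, a, ha⟩ := hρ
  refine ⟨Units.mk0 _ hd0, ⟨n * m, Nat.mul_pos hn hm, a, ?_⟩, ?_⟩
  · rw [Units.val_mk0, pow_mul, hd', ha]
  · ext
    rw [Units.val_pow_eq_pow_val, Units.val_mk0, hd']

/-- The ball of centre `α` and radius `ρ` with respect to the valuation of `U`. -/
def ball (U : ValuationSubring L) (α : L) (ρ : U.ValueGroupˣ) : Set L :=
  {x | U.valuation (x - α) ≤ ρ}

/-- The set of all balls with radius in the divisible hull, with the action
`(σ, B) ↦ σ(B)` of the decomposition group of `U`. -/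
def balls (U : ValuationSubring L) : SubMulAction (U.decompositionSubgroup K) (Set L) where
  carrier := {B | ∃ (α : L) (ρ : U.ValueGroupˣ), ρ ∈ hull K U ∧ B = ball U α ρ}
  smul_mem' := by
    rintro σ B ⟨α, ρ, ⟨n, hn, a, ha⟩, rfl⟩
    have hmem : ∀ x : L, (σ : L ≃ₐ[K] L) x ∈ U ↔ x ∈ U := fun x => by
      have h := ValuationSubring.smul_mem_pointwise_smul_iff (g := (σ : L ≃ₐ[K] L)) (S := U) (x := x)
      rwa [MulAction.mem_stabilizer_iff.mp σ.2] at h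
    have hle : ∀ x y : L, U.valuation ((σ : L ≃ₐ[K] L) x) ≤ U.valuation ((σ : L ≃ₐ[K] L) y) ↔
        U.valuation x ≤ U.valuation y := by
      intro x y
      rcases eq_or_ne y 0 with rfl | hy
      · simp
      · have hy' : (σ : L ≃ₐ[K] L) y ≠ 0 := by simpa using hy
        have h1 : 0 < U.valuation y := zero_lt_iff.mpr (by simpa using hy)
        have h2 : 0 < U.valuation ((σ : L ≃ₐ[K] L) y) := zero_lt_iff.mpr (by simpa using hy)
        rw [← div_le_one₀ h1, ← div_le_one₀ h2, ← map_div₀, ← map_div₀, ← map_div₀,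
          U.valuation_le_one_iff, U.valuation_le_one_iff, hmem]
    have heq : ∀ x y : L, U.valuation x = U.valuation y →
        U.valuation ((σ : L ≃ₐ[K] L) x) = U.valuation ((σ : L ≃ₐ[K] L) y) := fun x y h =>
      le_antisymm ((hle x y).mpr h.le) ((hle y x).mpr h.ge)
    obtain ⟨c, hc⟩ := U.valuation_surjective (ρ : U.ValueGroup)
    have hc0 : c ≠ 0 := by
      rintro rfl
      exact ρ.ne_zero (by simpa using hc.symm)
    have hσc : U.valuation ((σ : L ≃ₐ[K] L) c) ≠ 0 := by simpa using hc0
    refine ⟨(σ : L ≃ₐ[K] L) α, Units.mk0 _ hσc, ⟨n, hn, a, ?_⟩, ?_⟩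
    · rw [Units.val_mk0, ← map_pow, ← map_pow, ← AlgEquiv.commutes (σ : L ≃ₐ[K] L) a]
      exact heq _ _ (by rw [map_pow, hc, ha])
    · ext x
      obtain ⟨y, rfl⟩ := (σ : L ≃ₐ[K] L).surjective x
      have hy : (σ : L ≃ₐ[K] L) y = σ • y := rfl
      rw [hy, Set.smul_mem_smul_set_iff, ← hy]
      change U.valuation (y - α) ≤ ρ ↔
        U.valuation ((σ : L ≃ₐ[K] L) y - (σ : L ≃ₐ[K] L) α) ≤ U.valuation ((σ : L ≃ₐ[K] L) c)
      rw [← map_sub, hle, hc]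

variable {K}

/-- The ball as an element of the set of all balls. -/
def mkBall (U : ValuationSubring L) (α : L) (ρ : hull K U) : balls K U :=
  ⟨ball U α ρ, α, ρ, ρ.2, rfl⟩

/-- The inclusion `V → W` when `W ∩ F = V`, for a field extension `E / F`. -/
def inclusionOfComap {F : Type*} {E : Type*} [Field F] [Field E] [Algebra F E]
    (V : ValuationSubring F) (W : ValuationSubring E) (h : W.comap (algebraMap F E) = V) :
    V →+* W where
  toFun x := ⟨algebraMap F E x, by
    have hx : (x : F) ∈ W.comap (algebraMap F E) := h ▸ x.2
    exact hx⟩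
  map_one' := Subtype.ext (by simp)
  map_zero' := Subtype.ext (by simp)
  map_mul' x y := Subtype.ext (by simp)
  map_add' x y := Subtype.ext (by simp)

theorem isLocalHom_inclusionOfComap {F : Type*} {E : Type*} [Field F] [Field E] [Algebra F E]
    (V : ValuationSubring F) (W : ValuationSubring E) (h : W.comap (algebraMap F E) = V) :
    IsLocalHom (inclusionOfComap V W h) := by
  refine ⟨fun x hx => ?_⟩
  obtain ⟨y, hy⟩ := isUnit_iff_exists_inv.mp hx
  have hy' : algebraMap F E x * (y : E) = 1 := congrArg Subtype.val hy
  have hinv : (x : F)⁻¹ ∈ W.comap (algebraMap F E) := by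
    rw [ValuationSubring.mem_comap, map_inv₀, ← eq_inv_of_mul_eq_one_right hy']
    exact y.2
  have hx0 : (x : F) ≠ 0 := by
    intro h0
    rw [h0, map_zero, zero_mul] at hy'
    exact zero_ne_one hy'
  rw [h] at hinv
  exact isUnit_iff_exists_inv.mpr ⟨⟨_, hinv⟩, Subtype.ext (mul_inv_cancel₀ hx0)⟩

/-- The extension of residue fields `V/M_V → W/M_W` when `W ∩ F = V`. -/
noncomputable def residueMap {F : Type*} {E : Type*} [Field F] [Field E] [Algebra F E]
    (V : ValuationSubring F) (W : ValuationSubring E) (h : W.comap (algebraMap F E) = V) :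
    IsLocalRing.ResidueField V →+* IsLocalRing.ResidueField W :=
  letI := isLocalHom_inclusionOfComap V W h
  IsLocalRing.ResidueField.map (inclusionOfComap V W h)

/-- `W` is a residually transcendental extension of `V` to `K(X)`: it lies above `V`, and the
extension of residue fields is transcendental, i.e. some element of the residue field of `W` is
transcendental over that of `V`. -/
def IsResiduallyTranscendental (V : ValuationSubring K) (W : ValuationSubring (RatFunc K)) : Prop :=
  ∃ h : W.comap (algebraMap K (RatFunc K)) = V,
    letI := (residueMap V W h).toAlgebra
    Algebra.Transcendental (IsLocalRing.ResidueField V) (IsLocalRing.ResidueField W)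

end Extensions

end RTExt

/-! Write `L` for the algebraic closure and `u` for the valuation of `U`. Over `L` every rational
function is a product of constants and of factors `X - a` and their inverses, so a valuation on
`L(X)` is known from its values on constants and on the `X - a`. In multiplicative notation the
monomial valuation takes the value `max ρ (u (α - a))` at `X - a`, which depends only on the ball.
Conversely `(X - α) / d` with `u d = ρ` recovers the ball from the ring (`monomialRing_eq_iff`). The
correspondence between balls and monomial rings commutes with the decomposition group.

The fibres of `Θ` are single orbits because valuation rings of `L(X)` with the same trace on `K(X)`
are conjugate under `Gal(L/K)` (`exists_coeffAction_mem_iff`). If both have trace `U` on `L`, the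
conjugating automorphism preserves `U`. Conjugacy reduces to the transitive action of a profinite
group on the primes over a given prime of the invariant ring (`exists_smul_eq_of_fixed_mem_iff`).
Inseparability is harmless, since an element lies in a valuation ring as soon as a positive power
does.

The traces are residually transcendental because `fⁿ / a` has a transcendental residue, where `f`
over `K` vanishes at `α` and `a` matches the value of `fⁿ`
(`isResiduallyTranscendental_monomialRing`).

For surjectivity, extend `W` to `L(X)` and conjugate so that the trace on `L` is `U`. The residue
field is then larger than that of `U`, which forces the extension to be monomial
(`exists_isMonomial`): otherwise every function is, up to a factor congruent to `1`, a constant or a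
constant times a power of some `X - α` whose value is not that of a constant, and no new residue can
appear. -/

namespace RTExt

/-! ### Reduction to linear factors -/

section LinearFactors

variable {L : Type*} [Field L] [IsAlgClosed L]

/-- Over an algebraically closed field every polynomial is a product of a constant and linear
factors. -/
theorem polynomial_induction_linear {P : L[X] → Prop} (hC : ∀ c, P (Polynomial.C c))
    (hX : ∀ a, P (Polynomial.X - Polynomial.C a)) (hmul : ∀ f g, P f → P g → P (f * g)) (f : L[X]) :
    P f := by
  rw [(IsAlgClosed.splits f).eq_prod_roots]
  refine hmul _ _ (hC _) ?_
  induction f.roots using Multiset.induction with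
  | empty => simpa using hC 1
  | cons a s ih => simpa using hmul _ _ (hX a) ih

theorem ratFunc_induction_linear {P : RatFunc L → Prop} (hC : ∀ c, P (RatFunc.C c))
    (hX : ∀ a, P (RatFunc.X - RatFunc.C a)) (hmul : ∀ f g, P f → P g → P (f * g))
    (hinv : ∀ f, P f → P f⁻¹) (f : RatFunc L) : P f := by
  have key : ∀ p : L[X], P (algebraMap L[X] (RatFunc L) p) := fun p => by
    induction p using polynomial_induction_linear with
    | hC c => simpa using hC c
    | hX a => simpa using hX a
    | hmul f g hf hg => simpa using hmul _ _ hf hg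
  induction f using RatFunc.induction_on with
  | f p q hq => rw [div_eq_mul_inv]; exact hmul _ _ (key p) (hinv _ (key q))

theorem polynomial_valuation_ext {Γ : Type*} [LinearOrderedCommGroupWithZero Γ]
    {v w : Valuation L[X] Γ} (hC : ∀ c, v (Polynomial.C c) = w (Polynomial.C c))
    (hX : ∀ a, v (Polynomial.X - Polynomial.C a) = w (Polynomial.X - Polynomial.C a)) (f : L[X]) :
    v f = w f := by
  induction f using polynomial_induction_linear with
  | hC c => exact hC c
  | hX a => exact hX a
  | hmul f g hf hg => rw [map_mul, map_mul, hf, hg]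

end LinearFactors

/-! ### Values of monomial valuations -/

section Values

variable {L Γ : Type*} [Field L] [LinearOrderedCommGroupWithZero Γ]

theorem gaussFun_C (v : Valuation L Γ) (ρ : Γ) (c : L) : gaussFun v ρ (Polynomial.C c) = v c := by
  refine le_antisymm (gaussFun_le fun i => ?_) ?_
  · rcases eq_or_ne i 0 with rfl | hi
    · simp
    · simp [Polynomial.coeff_C, hi]
  · simpa using le_gaussFun v ρ (Polynomial.C c) 0

theorem gaussFun_X_add_C (v : Valuation L Γ) (ρ : Γ) (b : L) :
    gaussFun v ρ (Polynomial.X + Polynomial.C b) = max ρ (v b) := by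
  refine le_antisymm (gaussFun_le fun i => ?_) (max_le ?_ ?_)
  · match i with
    | 0 => simp
    | 1 => simp
    | i + 2 => simp [Polynomial.coeff_X]
  · have h := le_gaussFun v ρ (Polynomial.X + Polynomial.C b) 1
    rwa [Polynomial.coeff_add, Polynomial.coeff_X_one, Polynomial.coeff_C_succ, add_zero, map_one,
      one_mul, pow_one] at h
  · have h := le_gaussFun v ρ (Polynomial.X + Polynomial.C b) 0
    rwa [Polynomial.coeff_add, Polynomial.coeff_X_zero, Polynomial.coeff_C_zero, zero_add, pow_zero,
      mul_one] at h

/-- The constant `b` meets no other term of degree `0`, so nothing cancels. This will show that no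
constant approximates `fⁿ / a`. -/
theorem gaussFun_sub_C (v : Valuation L Γ) (ρ : Γ) {f : L[X]} (hf : f.coeff 0 = 0) (b : L) :
    gaussFun v ρ (f - Polynomial.C b) = max (gaussFun v ρ f) (v b) := by
  refine le_antisymm (gaussFun_le fun i => ?_) (max_le (gaussFun_le fun i => ?_) ?_)
  · rcases eq_or_ne i 0 with rfl | hi
    · simp [hf]
    · rw [Polynomial.coeff_sub, Polynomial.coeff_C, if_neg hi, sub_zero]
      exact (le_gaussFun v ρ f i).trans (le_max_left _ _)
  · rcases eq_or_ne i 0 with rfl | hi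
    · simp [hf]
    · simpa [Polynomial.coeff_C, hi] using le_gaussFun v ρ (f - Polynomial.C b) i
  · simpa [hf] using le_gaussFun v ρ (f - Polynomial.C b) 0

theorem monomialValuationRat_algebraMap (v : Valuation L Γ) (α : L) (ρ : Γˣ) (f : L[X]) :
    monomialValuationRat v α ρ (algebraMap L[X] (RatFunc L) f) =
      gaussFun v ρ (Polynomial.taylor α f) :=
  Valuation.extendToLocalization_apply_map_apply _ _ _ _

@[simp]
theorem monomialValuationRat_C (v : Valuation L Γ) (α : L) (ρ : Γˣ) (c : L) :
    monomialValuationRat v α ρ (RatFunc.C c) = v c := by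
  rw [← RatFunc.algebraMap_C, monomialValuationRat_algebraMap, Polynomial.taylor_C, gaussFun_C]

theorem monomialValuationRat_X_sub_C (v : Valuation L Γ) (α : L) (ρ : Γˣ) (a : L) :
    monomialValuationRat v α ρ (RatFunc.X - RatFunc.C a) = max (ρ : Γ) (v (α - a)) := by
  rw [← RatFunc.algebraMap_C, ← RatFunc.algebraMap_X, ← map_sub, monomialValuationRat_algebraMap,
    map_sub, Polynomial.taylor_X, Polynomial.taylor_C, add_sub_assoc, ← map_sub, gaussFun_X_add_C]

end Values

/-! ### Uniqueness of monomial valuations -/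

section Monomial

variable {L Γ : Type*} [Field L] [LinearOrderedCommGroupWithZero Γ]

/-- A valuation on `L(X)` is monomial with centre `α` and radius the value of `d`. -/
def IsMonomial (w : Valuation (RatFunc L) Γ) (α d : L) : Prop :=
  ∀ a, w (RatFunc.X - RatFunc.C a) = max (w (RatFunc.C d)) (w (RatFunc.C (α - a)))

theorem isMonomial_monomialValuationRat (v : Valuation L Γ) (α : L) {ρ : Γˣ} {d : L}
    (hd : v d = ρ) : IsMonomial (monomialValuationRat v α ρ) α d := fun a => by
  rw [monomialValuationRat_X_sub_C, monomialValuationRat_C, monomialValuationRat_C, hd]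

/-- Each `X - a` has the value of one of the constants `d` and `α - a`, and agreement on constants
makes the choice the same for `w` and `w'`. Multiplicatively, every function then has the value of
one constant for both valuations. -/
theorem IsMonomial.le_one_iff [IsAlgClosed L] {Γ' : Type*} [LinearOrderedCommGroupWithZero Γ']
    {w : Valuation (RatFunc L) Γ} {w' : Valuation (RatFunc L) Γ'} {α d : L}
    (hw : IsMonomial w α d) (hw' : IsMonomial w' α d)
    (h : ∀ c : L, w (RatFunc.C c) ≤ 1 ↔ w' (RatFunc.C c) ≤ 1) (y : RatFunc L) :
    w y ≤ 1 ↔ w' y ≤ 1 := by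
  have hE : (w.comap (RatFunc.C : L →+* RatFunc L)).IsEquiv (w'.comap RatFunc.C) :=
    Valuation.isEquiv_iff_val_le_one.mpr fun {c} => h c
  suffices ∃ c, w y = w (RatFunc.C c) ∧ w' y = w' (RatFunc.C c) by
    obtain ⟨c, hc, hc'⟩ := this
    rw [hc, hc', h]
  induction y using ratFunc_induction_linear with
  | hC c => exact ⟨c, rfl, rfl⟩
  | hX a =>
    have hle : w (RatFunc.C d) ≤ w (RatFunc.C (α - a)) ↔
        w' (RatFunc.C d) ≤ w' (RatFunc.C (α - a)) := hE d (α - a)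
    rw [hw a, hw' a]
    rcases le_total (w (RatFunc.C d)) (w (RatFunc.C (α - a))) with hda | hda
    · exact ⟨α - a, max_eq_right hda, max_eq_right (hle.mp hda)⟩
    · exact ⟨d, max_eq_left hda, max_eq_left ((hE (α - a) d).mp hda)⟩
  | hmul f g hf hg =>
    obtain ⟨c, hc, hc'⟩ := hf
    obtain ⟨e, he, he'⟩ := hg
    exact ⟨c * e, by simp only [map_mul, hc, he], by simp only [map_mul, hc', he']⟩
  | hinv f hf =>
    obtain ⟨c, hc, hc'⟩ := hf
    exact ⟨c⁻¹, by simp only [map_inv₀, hc], by simp only [map_inv₀, hc']⟩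

end Monomial

/-! ### Valuations with a larger residue field are monomial -/

section Existence

variable {F Γ : Type*} [Field F] [LinearOrderedCommGroupWithZero Γ] (w : Valuation F Γ)

theorem map_eq_one_of_sub_one_lt {z : F} (hz : w (z - 1) < 1) : w z = 1 := by
  have := w.map_add_eq_of_lt_right (x := z - 1) (y := 1) (by simpa using hz)
  simpa using this

theorem mul_sub_one_lt {z z' : F} (hz : w (z - 1) < 1) (hz' : w (z' - 1) < 1) :
    w (z * z' - 1) < 1 := by
  rw [show z * z' - 1 = (z - 1) * z' + (z' - 1) by ring]
  refine w.map_add_lt ?_ hz'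
  rwa [map_mul, map_eq_one_of_sub_one_lt w hz', mul_one]

theorem inv_sub_one_lt {z : F} (hz : w (z - 1) < 1) : w (z⁻¹ - 1) < 1 := by
  have h1 := map_eq_one_of_sub_one_lt w hz
  have hz0 : z ≠ 0 := by rintro rfl; simp at h1
  rw [show z⁻¹ - 1 = -((z - 1) * z⁻¹) by field_simp; ring, Valuation.map_neg, map_mul, map_inv₀, h1]
  simpa using hz

variable {w}

theorem exists_eq_mul_of_lt {x c y : F} (hy : y = c + x) (h : w x < w c) :
    ∃ z, w (z - 1) < 1 ∧ y = c * z := by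
  have hc : c ≠ 0 := by rintro rfl; simp at h
  have hc' : w c ≠ 0 := by simpa using hc
  refine ⟨y / c, ?_, by field_simp⟩
  rw [hy, show (c + x) / c - 1 = x / c by field_simp; ring, map_div₀]
  exact (div_lt_one₀ (zero_lt_iff.mpr hc')).mpr h

end Existence

section Existence

variable {L Γ : Type*} [Field L] [LinearOrderedCommGroupWithZero Γ]
  {w : Valuation (RatFunc L) Γ}

/-- In `X - a = (X - α) + (α - a)` the two terms have different values when `a ≠ α`, so one
dominates and the quotient by it is congruent to `1`. -/
theorem eq_C_mul_zpow_mul [IsAlgClosed L] {α : L} (hα : ∀ d ≠ 0, w (RatFunc.X - RatFunc.C α) ≠ w (RatFunc.C d))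
    (y : RatFunc L) : y = 0 ∨ ∃ (c : L) (n : ℤ) (z : RatFunc L), c ≠ 0 ∧ w (z - 1) < 1 ∧
      y = RatFunc.C c * (RatFunc.X - RatFunc.C α) ^ n * z := by
  have hXα : (RatFunc.X - RatFunc.C α : RatFunc L) ≠ 0 := by
    rw [← RatFunc.algebraMap_C, ← RatFunc.algebraMap_X, ← map_sub]
    exact RatFunc.algebraMap_ne_zero (Polynomial.X_sub_C_ne_zero α)
  induction y using ratFunc_induction_linear with
  | hC c =>
    rcases eq_or_ne c 0 with rfl | hc
    · simp
    · exact .inr ⟨c, 0, 1, hc, by simp, by simp⟩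
  | hX a =>
    right
    rcases eq_or_ne a α with rfl | ha
    · exact ⟨1, 1, 1, one_ne_zero, by simp, by simp⟩
    have ha' : α - a ≠ 0 := sub_ne_zero.mpr ha.symm
    rcases lt_or_gt_of_ne (hα _ ha') with h | h
    · obtain ⟨z, hz, hz'⟩ := exists_eq_mul_of_lt (y := RatFunc.X - RatFunc.C a)
        (by rw [map_sub]; ring) h
      exact ⟨α - a, 0, z, ha', hz, by simpa using hz'⟩
    · obtain ⟨z, hz, hz'⟩ := exists_eq_mul_of_lt (y := RatFunc.X - RatFunc.C a)
        (by rw [map_sub]; ring) h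
      exact ⟨1, 1, z, one_ne_zero, hz, by simpa using hz'⟩
  | hmul f g hf hg =>
    rcases hf with rfl | ⟨c, n, z, hc, hz, rfl⟩
    · simp
    rcases hg with rfl | ⟨c', n', z', hc', hz', rfl⟩
    · simp
    refine .inr ⟨c * c', n + n', z * z', mul_ne_zero hc hc', mul_sub_one_lt w hz hz', ?_⟩
    rw [zpow_add₀ hXα, map_mul]
    ring
  | hinv f hf =>
    rcases hf with rfl | ⟨c, n, z, hc, hz, rfl⟩
    · simp
    exact .inr ⟨c⁻¹, -n, z⁻¹, inv_ne_zero hc, inv_sub_one_lt w hz, by rw [mul_inv, mul_inv, map_inv₀, zpow_neg]⟩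

/-- If `α` is closer to `X` than `a` is, the constant `α - a` dominates in `X - a`. A function
involves finitely many `a`, and `β` is the closest one to `X`. -/
theorem exists_eq_C_mul [IsAlgClosed L] (y : RatFunc L) : y = 0 ∨ ∃ β : L, ∀ α : L,
    w (RatFunc.X - RatFunc.C α) < w (RatFunc.X - RatFunc.C β) →
      ∃ (c : L) (z : RatFunc L), w (z - 1) < 1 ∧ y = RatFunc.C c * z := by
  induction y using ratFunc_induction_linear with
  | hC c => exact .inr ⟨0, fun α _ => ⟨c, 1, by simp, by simp⟩⟩
  | hX a =>
    refine .inr ⟨a, fun α hα => ?_⟩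
    have h := w.map_sub_eq_of_lt_right hα
    have hval : w (RatFunc.C (α - a)) = w (RatFunc.X - RatFunc.C a) := by
      rw [← h, ← Valuation.map_neg, map_sub]
      congr 1
      ring
    obtain ⟨z, hz, hz'⟩ := exists_eq_mul_of_lt (y := RatFunc.X - RatFunc.C a)
      (by rw [map_sub]; ring) (hval ▸ hα)
    exact ⟨α - a, z, hz, hz'⟩
  | hmul f g hf hg =>
    rcases hf with rfl | ⟨β, hβ⟩
    · simp
    rcases hg with rfl | ⟨γ, hγ⟩
    · simp
    right
    rcases le_total (w (RatFunc.X - RatFunc.C β)) (w (RatFunc.X - RatFunc.C γ)) with h | h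
    · refine ⟨β, fun α hα => ?_⟩
      obtain ⟨c, z, hz, rfl⟩ := hβ α hα
      obtain ⟨c', z', hz', rfl⟩ := hγ α (hα.trans_le h)
      exact ⟨c * c', z * z', mul_sub_one_lt w hz hz', by rw [map_mul]; ring⟩
    · refine ⟨γ, fun α hα => ?_⟩
      obtain ⟨c, z, hz, rfl⟩ := hβ α (hα.trans_le h)
      obtain ⟨c', z', hz', rfl⟩ := hγ α hα
      exact ⟨c * c', z * z', mul_sub_one_lt w hz hz', by rw [map_mul]; ring⟩
  | hinv f hf =>
    rcases hf with rfl | ⟨β, hβ⟩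
    · simp
    refine .inr ⟨β, fun α hα => ?_⟩
    obtain ⟨c, z, hz, rfl⟩ := hβ α hα
    exact ⟨c⁻¹, z⁻¹, inv_sub_one_lt w hz, by rw [mul_inv, map_inv₀]⟩

/-- Such a `t` would have the residue of the constant `c`. -/
theorem false_of_eq_C_mul {t z : RatFunc L} {c : L} (ht : w t = 1)
    (htc : ∀ c : L, w (RatFunc.C c) ≤ 1 → w (t - RatFunc.C c) = 1) (hz : w (z - 1) < 1)
    (h : t = RatFunc.C c * z) : False := by
  have hc : w (RatFunc.C c) = 1 := by
    rw [← ht, h, map_mul, map_eq_one_of_sub_one_lt w hz, mul_one]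
  have h1 := htc c hc.le
  rw [h, show RatFunc.C c * z - RatFunc.C c = RatFunc.C c * (z - 1) by ring, map_mul, hc,
    one_mul] at h1
  exact hz.ne h1

/-- A valuation on `L(X)` whose residue field is larger than that of `L` is monomial. -/
theorem exists_isMonomial [IsAlgClosed L] {t : RatFunc L}
    (htc : ∀ c : L, w (RatFunc.C c) ≤ 1 → w (t - RatFunc.C c) = 1) :
    ∃ α d : L, d ≠ 0 ∧ IsMonomial w α d := by
  have ht : w t = 1 := by simpa using htc 0 (by simp)
  have ht0 : t ≠ 0 := by rintro rfl; simp at ht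
  by_contra! hcon
  -- Either some `X - α` has a value not taken by nonzero constants, or all of them take such values
  -- and, without a monomial description, no `α` is closest to `X`.
  by_cases h : ∃ α, ∀ d ≠ 0, w (RatFunc.X - RatFunc.C α) ≠ w (RatFunc.C d)
  · obtain ⟨α, hα⟩ := h
    obtain ⟨c, n, z, hc, hz, htz⟩ := (eq_C_mul_zpow_mul hα t).resolve_left ht0
    rcases eq_or_ne n 0 with rfl | hn
    · exact false_of_eq_C_mul ht htc hz (by simpa using htz)
    have hval : w (RatFunc.C c) * w (RatFunc.X - RatFunc.C α) ^ n = 1 := by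
      rw [← ht, htz, map_mul, map_mul, map_eq_one_of_sub_one_lt w hz, mul_one, map_zpow₀]
    obtain ⟨m, hm, hmn⟩ : ∃ m : ℕ, 0 < m ∧ (n = m ∨ n = -m) :=
      ⟨n.natAbs, Int.natAbs_pos.mpr hn, Int.natAbs_eq n⟩
    have hcw : w (RatFunc.C c) ≠ 0 := by simpa using hc
    -- As `w t = 1`, a power of `X - α` has the value of a constant `e`. An `m`-th root of `e` then
    -- has the value of `X - α`, against the choice of `α`.
    obtain ⟨e, he, hXe⟩ : ∃ e : L, e ≠ 0 ∧ w (RatFunc.X - RatFunc.C α) ^ m = w (RatFunc.C e) := by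
      rcases hmn with rfl | rfl
      · refine ⟨c⁻¹, inv_ne_zero hc, ?_⟩
        rw [zpow_natCast] at hval
        rw [map_inv₀, map_inv₀]
        exact eq_inv_of_mul_eq_one_right hval
      · refine ⟨c, hc, ?_⟩
        rw [zpow_neg, zpow_natCast] at hval
        exact (eq_of_mul_inv_eq_one hval).symm
    obtain ⟨d, hd⟩ := IsAlgClosed.exists_pow_nat_eq e hm
    have hd0 : d ≠ 0 := by rintro rfl; exact he (by rw [← hd, zero_pow hm.ne'])
    refine hα d hd0 ?_
    rw [← hd, map_pow, map_pow] at hXe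
    exact (pow_left_inj₀ zero_le zero_le hm.ne').mp hXe
  · push Not at h
    have hlt : ∀ α, ∃ a, w (RatFunc.X - RatFunc.C a) < w (RatFunc.X - RatFunc.C α) := by
      intro α
      obtain ⟨d, hd, hwd⟩ := h α
      have := hcon α d hd
      rw [IsMonomial] at this
      push Not at this
      obtain ⟨a, ha⟩ := this
      have hsum : (RatFunc.X - RatFunc.C a : RatFunc L)
          = (RatFunc.X - RatFunc.C α) + RatFunc.C (α - a) := by rw [map_sub]; ring
      rw [← hwd] at ha
      -- The monomial formula can fail at `a` only through cancellation between two terms of equal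
      -- value, which makes `X - a` strictly smaller than `X - α`.
      have heq : w (RatFunc.X - RatFunc.C α) = w (RatFunc.C (α - a)) := by
        by_contra hne
        exact ha (by rw [hsum, w.map_add_of_distinct_val hne])
      rw [← heq, max_self] at ha
      refine ⟨a, lt_of_le_of_ne ?_ ha⟩
      rw [hsum]
      exact (w.map_add _ _).trans (by rw [← heq, max_self])
    obtain ⟨β, hβ⟩ := (exists_eq_C_mul (w := w) t).resolve_left ht0
    obtain ⟨a, ha⟩ := hlt β
    obtain ⟨c, z, hz, htz⟩ := hβ a ha
    exact false_of_eq_C_mul ht htc hz htz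

end Existence

/-! ### Valuation rings determined by their centres -/

section Center

variable {E : Type*} [Field E]

theorem valuation_lt_one_iff_inv_notMem (U : ValuationSubring E) (x : E) :
    U.valuation x < 1 ↔ x = 0 ∨ x⁻¹ ∉ U := by
  rcases eq_or_ne x 0 with rfl | hx
  · simp
  · have hx' : 0 < U.valuation x := zero_lt_iff.mpr (by simpa using hx)
    rw [← U.valuation_le_one_iff, map_inv₀, inv_le_one₀ hx', not_le]
    simp [hx]

/-- If `x` is a root of `∑ aᵢ Xⁱ`, the two halves of the sum obtained by cutting at index `k` give
a representation of `x` as a quotient of two elements of every valuation ring containing the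
coefficients. -/
theorem exists_mul_eq_neg {x : E} (hx : x ≠ 0) (a : ℕ → E) (k N : ℕ)
    (h : ∑ i ∈ Finset.range (k + N), a i * x ^ i = 0) :
    ∃ b c : E, b * x = -c ∧
      (∀ U : ValuationSubring E, (∀ i, a i ∈ U) → b ∈ U ∧ c ∈ U) ∧
      ∀ U : ValuationSubring E, U.valuation (a k) = 1 → (∀ i > k, U.valuation (a i) < 1) →
        x ∈ U → 0 < N → U.valuation b = 1 := by
  set b := ∑ i ∈ Finset.range N, a (k + i) * x ^ i with hb
  set c := ∑ j ∈ Finset.range k, a (k - 1 - j) * x⁻¹ ^ j with hc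
  have hbc : b * x = -c := by
    rw [Finset.sum_range_add, ← Finset.sum_range_reflect] at h
    -- Writing `x ^ k * x⁻¹` instead of `x ^ (k - 1)` keeps the case `k = 0` uniform.
    have h1 : ∑ j ∈ Finset.range k, a (k - 1 - j) * x ^ (k - 1 - j) = x ^ k * x⁻¹ * c := by
      rw [hc, Finset.mul_sum]
      refine Finset.sum_congr rfl fun j hj => ?_
      have hj : j < k := Finset.mem_range.mp hj
      have hk : x ^ k = x ^ (k - 1 - j) * x * x ^ j := by
        rw [← pow_succ, ← pow_add]; congr 1; omega
      rw [hk, inv_pow]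
      have := pow_ne_zero j hx
      field_simp
    have h2 : ∑ i ∈ Finset.range N, a (k + i) * x ^ (k + i) = x ^ k * b := by
      rw [hb, Finset.mul_sum]
      exact Finset.sum_congr rfl fun i _ => by rw [pow_add]; ring
    rw [h1, h2] at h
    have hxk := pow_ne_zero k hx
    have h3 : x ^ k * (c + b * x) = 0 := by
      calc x ^ k * (c + b * x) = (x ^ k * x⁻¹ * c + x ^ k * b) * x := by field_simp
        _ = 0 := by rw [h, zero_mul]
    exact eq_neg_of_add_eq_zero_right ((mul_eq_zero.mp h3).resolve_left hxk)
  refine ⟨b, c, hbc, fun U hU => ?_, fun U hk hi hxU hN => ?_⟩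
  -- `b` is a polynomial in `x` and `c` one in `x⁻¹`. Whichever of `x`, `x⁻¹` lies in `U` handles
  -- one of them, and `b * x = -c` handles the other.
  · rcases U.mem_or_inv_mem x with hxU | hxU
    · have hbU : b ∈ U := sum_mem fun i _ => mul_mem (hU _) (pow_mem hxU i)
      refine ⟨hbU, ?_⟩
      rw [← neg_neg c, ← hbc]
      exact neg_mem (mul_mem hbU hxU)
    · have hcU : c ∈ U := sum_mem fun i _ => mul_mem (hU _) (pow_mem hxU i)
      refine ⟨?_, hcU⟩
      rw [← mul_inv_cancel_right₀ hx b, hbc]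
      exact mul_mem (neg_mem hcU) hxU
  · obtain ⟨M, rfl⟩ := Nat.exists_eq_add_of_lt hN
    rw [hb, zero_add, Finset.sum_range_succ', pow_zero, mul_one, add_zero,
      U.valuation.map_add_eq_of_lt_right, hk]
    rw [hk]
    refine U.valuation.map_sum_lt one_ne_zero fun i _ => ?_
    rw [map_mul, map_pow]
    exact mul_lt_one_of_lt_of_le (hi _ (by omega))
      (pow_le_one' ((U.valuation_le_one_iff x).mpr hxU) _)

/-- A nonzero polynomial has a coefficient of maximal value, with maximal index. -/
theorem exists_max_coeff {Γ : Type*} [LinearOrderedCommGroupWithZero Γ] (v : Valuation E Γ)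
    {p : E[X]} (hp : p ≠ 0) :
    ∃ k, p.coeff k ≠ 0 ∧ (∀ i, v (p.coeff i) ≤ v (p.coeff k)) ∧
      ∀ i > k, v (p.coeff i) < v (p.coeff k) := by
  obtain ⟨j, hj, hjmax⟩ := p.support.exists_max_image (fun i => v (p.coeff i))
    (Polynomial.support_nonempty.mpr hp)
  obtain ⟨k, hk, hkmax⟩ := (p.support.filter fun i => v (p.coeff i) = v (p.coeff j)).exists_max_image
    id ⟨j, by simpa using hj⟩
  obtain ⟨hk, hkj⟩ := Finset.mem_filter.mp hk
  have hle : ∀ i, v (p.coeff i) ≤ v (p.coeff k) := fun i => by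
    by_cases hi : i ∈ p.support
    · exact (hjmax i hi).trans hkj.ge
    · simp [Polynomial.notMem_support_iff.mp hi]
  refine ⟨k, Polynomial.mem_support_iff.mp hk, hle, fun i hi => lt_of_le_of_ne (hle i) fun heq => ?_⟩
  have his : i ∈ p.support := by
    rw [Polynomial.mem_support_iff]
    intro h0
    rw [h0, map_zero] at heq
    exact Polynomial.mem_support_iff.mp hk (by simpa using heq.symm)
  exact absurd (hkmax i (Finset.mem_filter.mpr ⟨his, heq.trans hkj⟩)) (not_le.mpr hi)

/-- Let `𝒰` be a set of valuation rings with the same trace on a subfield `F` over which `E` is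
algebraic. A member of `𝒰` is determined by its centre on the intersection of `𝒰`. -/
theorem le_of_center_le (F : Subfield E) [Algebra.IsAlgebraic F E] (𝒰 : Set (ValuationSubring E))
    {U₁ U₂ : ValuationSubring E} (h₂ : U₂ ∈ 𝒰)
    (hF : ∀ U ∈ 𝒰, ∀ x ∈ F, x ∈ U ↔ x ∈ U₁)
    (hc : ∀ b, (∀ U ∈ 𝒰, b ∈ U) → U₂.valuation b < 1 → U₁.valuation b < 1) : U₁ ≤ U₂ := by
  intro x hx
  rcases eq_or_ne x 0 with rfl | hx0
  · exact zero_mem _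
  obtain ⟨p, hp, hpx⟩ := Algebra.IsAlgebraic.isAlgebraic (R := F) x
  -- Dividing by the last coefficient of maximal value makes `b` a unit of `U₁`. By the hypothesis
  -- on centres `b` is then a unit of `U₂`, and `x = -c / b` lies in `U₂`.
  obtain ⟨k, hk, hkle, hklt⟩ := exists_max_coeff (U₁.valuation.comap (algebraMap F E)) hp
  set a : ℕ → E := fun i => ((p.coeff i / p.coeff k : F) : E) with ha
  have hval : ∀ i, U₁.valuation (a i) =
      U₁.valuation (algebraMap F E (p.coeff i)) / U₁.valuation (algebraMap F E (p.coeff k)) :=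
    fun i => by rw [← map_div₀, ← map_div₀]; rfl
  have hk0 : 0 < U₁.valuation (algebraMap F E (p.coeff k)) := zero_lt_iff.mpr (by simpa using hk)
  have haF : ∀ i, a i ∈ F := fun i => (p.coeff i / p.coeff k : F).2
  have haU₁ : ∀ i, a i ∈ U₁ := fun i => by
    rw [← U₁.valuation_le_one_iff, hval]
    exact div_le_one_of_le₀ (hkle i) zero_le
  have hsum : ∑ i ∈ Finset.range (k + (p.natDegree + 1)), a i * x ^ i = 0 := by
    have h1 := Polynomial.aeval_eq_sum_range' (p := p) (n := k + (p.natDegree + 1)) (by omega) x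
    rw [hpx] at h1
    calc ∑ i ∈ Finset.range (k + (p.natDegree + 1)), a i * x ^ i
        = ((p.coeff k : F) : E)⁻¹ * ∑ i ∈ Finset.range (k + (p.natDegree + 1)), p.coeff i • x ^ i := by
          rw [Finset.mul_sum]
          refine Finset.sum_congr rfl fun i _ => ?_
          rw [Subfield.smul_def, smul_eq_mul, ha]
          push_cast
          ring
      _ = 0 := by rw [← h1, mul_zero]
  obtain ⟨b, c, hbc, hmem, hunit⟩ := exists_mul_eq_neg hx0 a k _ hsum
  have hbcU : ∀ U ∈ 𝒰, b ∈ U ∧ c ∈ U := fun U hU =>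
    hmem U fun i => (hF U hU _ (haF i)).mpr (haU₁ i)
  have hb₁ : U₁.valuation b = 1 := hunit U₁ (by rw [hval, div_self hk0.ne'])
    (fun i hi => by rw [hval, div_lt_one₀ hk0]; exact hklt i hi) hx (by omega)
  have hb₂ : ¬ U₂.valuation b < 1 := fun h =>
    (hc b (fun U hU => (hbcU U hU).1) h).ne hb₁
  rw [valuation_lt_one_iff_inv_notMem, not_or, not_not] at hb₂
  have hxb : x = -c * b⁻¹ := by
    rw [← hbc, mul_comm b x, mul_inv_cancel_right₀ hb₂.1]
  rw [hxb]
  exact mul_mem (neg_mem (hbcU U₂ h₂).2) hb₂.2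

end Center

/-! ### Conjugacy under a profinite group -/

section Conjugacy

variable {E : Type*} [Field E] {G : Type*} [Group G] [MulSemiringAction G E]

theorem valuation_smul_lt_one_iff (U : ValuationSubring E) (g : G) (x : E) :
    (g • U).valuation (g • x) < 1 ↔ U.valuation x < 1 := by
  rw [valuation_lt_one_iff_inv_notMem, valuation_lt_one_iff_inv_notMem, smul_eq_zero_iff_eq,
    ← smul_inv'', ValuationSubring.smul_mem_pointwise_smul_iff]

/-- The intersection of all conjugates of two valuation rings. -/
def conjInter (G : Type*) [Group G] [MulSemiringAction G E] (U₁ U₂ : ValuationSubring E) :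
    Subring E :=
  ⨅ g : G, (g • U₁).toSubring ⊓ (g • U₂).toSubring

theorem mem_conjInter {U₁ U₂ : ValuationSubring E} {x : E} :
    x ∈ conjInter G U₁ U₂ ↔ ∀ g : G, x ∈ g • U₁ ∧ x ∈ g • U₂ := by
  simp only [conjInter, Subring.mem_iInf]
  exact Iff.rfl

instance (U₁ U₂ : ValuationSubring E) : IsInvariantSubring G (conjInter G U₁ U₂) where
  smul_mem g x hx := by
    rw [mem_conjInter] at hx ⊢
    intro h
    have := hx (g⁻¹ * h)
    rwa [mul_smul, mul_smul, ValuationSubring.mem_inv_pointwise_smul_iff,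
      ValuationSubring.mem_inv_pointwise_smul_iff] at this

/-- The centre of a valuation ring on a subring. -/
def center {B : Subring E} {U : ValuationSubring E} (h : B ≤ U.toSubring) : Ideal B :=
  (IsLocalRing.maximalIdeal U).comap (Subring.inclusion h : B →+* U)

instance {B : Subring E} {U : ValuationSubring E} (h : B ≤ U.toSubring) : (center h).IsPrime :=
  Ideal.comap_isPrime _ _

theorem mem_center {B : Subring E} {U : ValuationSubring E} (h : B ≤ U.toSubring) (x : B) :
    x ∈ center h ↔ U.valuation (x : E) < 1 :=
  U.valuation_lt_one_iff ⟨x, h x.2⟩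

/-- A profinite group with open stabilisers acts transitively on the valuation rings with a given
trace on the fixed field. -/
theorem exists_smul_eq_of_fixed_mem_iff [TopologicalSpace G] [CompactSpace G]
    [TotallyDisconnectedSpace G] [IsTopologicalGroup G]
    (hstab : ∀ x : E, IsOpen (MulAction.stabilizer G x : Set G)) (U₁ U₂ : ValuationSubring E)
    (hfix : ∀ x : E, (∀ g : G, g • x = x) → (x ∈ U₁ ↔ x ∈ U₂)) : ∃ g : G, g • U₁ = U₂ := by
  let _ : TopologicalSpace E := ⊥
  have : DiscreteTopology E := ⟨rfl⟩
  have : ContinuousSMul G E := continuousSMul_iff_stabilizer_isOpen.mpr hstab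
  have : Algebra.IsInvariant (FixedPoints.subfield G E) E G := ⟨fun x hx => ⟨⟨x, hx⟩, rfl⟩⟩
  have : Algebra.IsIntegral (FixedPoints.subfield G E) E :=
    Algebra.IsInvariant.isIntegral_of_profinite (G := G)
  let B := conjInter G U₁ U₂
  let _ : TopologicalSpace B := ⊥
  have : DiscreteTopology B := ⟨rfl⟩
  have : ContinuousSMul G B := continuousSMul_iff_stabilizer_isOpen.mpr fun x => by
    convert hstab (x : E) using 1
    ext g
    exact Subtype.ext_iff
  have : Algebra.IsInvariant (FixedPoints.subring B G) B G := ⟨fun x hx => ⟨⟨x, hx⟩, rfl⟩⟩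
  have hB₁ : B ≤ U₁.toSubring := fun x hx => by
    simpa using (mem_conjInter.mp hx (1 : G)).1
  have hB₂ : B ≤ U₂.toSubring := fun x hx => by
    simpa using (mem_conjInter.mp hx (1 : G)).2
  -- A nonzero `x` lies in a centre exactly when `x⁻¹` is outside the valuation ring. For fixed `x`
  -- the inverse is fixed too, so `hfix` compares the two centres.
  have hunder : (center hB₁).under (FixedPoints.subring B G) =
      (center hB₂).under (FixedPoints.subring B G) := by
    ext x
    have hx : ∀ g : G, g • ((x : B) : E) = ((x : B) : E) := fun g => congrArg Subtype.val (x.2 g)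
    change (x : B) ∈ center hB₁ ↔ (x : B) ∈ center hB₂
    rw [mem_center, mem_center, valuation_lt_one_iff_inv_notMem, valuation_lt_one_iff_inv_notMem,
      hfix _ fun g => by rw [smul_inv'', hx]]
  obtain ⟨g, hg⟩ := Algebra.IsInvariant.exists_smul_of_under_eq_of_profinite
    (A := FixedPoints.subring B G) (G := G) (center hB₁) (center hB₂) hunder
  have hcenter : ∀ b, b ∈ B → ((g • U₁).valuation b < 1 ↔ U₂.valuation b < 1) := fun b hb => by
    have h1 : (⟨b, hb⟩ : B) ∈ center hB₂ ↔ g⁻¹ • (⟨b, hb⟩ : B) ∈ center hB₁ := by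
      rw [hg, Ideal.mem_pointwise_smul_iff_inv_smul_mem]
    rw [mem_center, mem_center] at h1
    rw [h1]
    have h2 := valuation_smul_lt_one_iff U₁ g (g⁻¹ • b)
    rwa [smul_inv_smul] at h2
  have hF₁ : ∀ (h : G) (x : E), (∀ g : G, g • x = x) → (x ∈ h • U₁ ↔ x ∈ U₁) := fun h x hx => by
    rw [ValuationSubring.mem_pointwise_smul_iff_inv_smul_mem, hx]
  have hF₂ : ∀ (h : G) (x : E), (∀ g : G, g • x = x) → (x ∈ h • U₂ ↔ x ∈ U₂) := fun h x hx => by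
    rw [ValuationSubring.mem_pointwise_smul_iff_inv_smul_mem, hx]
  -- `B` is the intersection of this family, whose members all have the same trace on the fixed
  -- field, so equal centres on `B` give equal rings.
  let 𝒰 : Set (ValuationSubring E) := Set.range (fun h : G => h • U₁) ∪ Set.range fun h : G => h • U₂
  have hmem : ∀ b, (∀ U ∈ 𝒰, b ∈ U) → b ∈ B := fun b hb =>
    mem_conjInter.mpr fun h => ⟨hb _ (.inl ⟨h, rfl⟩), hb _ (.inr ⟨h, rfl⟩)⟩
  have hFmem : ∀ U ∈ 𝒰, ∀ x ∈ FixedPoints.subfield G E, x ∈ U ↔ x ∈ U₁ := by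
    rintro _ (⟨h, rfl⟩ | ⟨h, rfl⟩) x hx
    · exact hF₁ h x hx
    · exact (hF₂ h x hx).trans (hfix x hx).symm
  have hU₁ : g • U₁ ∈ 𝒰 := .inl ⟨g, rfl⟩
  have hU₂ : U₂ ∈ 𝒰 := .inr ⟨1, one_smul _ _⟩
  refine ⟨g, le_antisymm ?_ ?_⟩
  · exact le_of_center_le (FixedPoints.subfield G E) 𝒰 hU₂
      (fun U hU x hx => (hFmem U hU x hx).trans (hFmem _ hU₁ x hx).symm)
      fun b hb => (hcenter b (hmem b hb)).mpr
  · exact le_of_center_le (FixedPoints.subfield G E) 𝒰 hU₁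
      (fun U hU x hx => (hFmem U hU x hx).trans (hFmem _ hU₂ x hx).symm)
      fun b hb => (hcenter b (hmem b hb)).mp

end Conjugacy

/-! ### Maps on coefficients -/

section CoeffMap

variable {F L : Type*} [Field F] [Field L]

/-- The map `F(X) → L(X)` induced by a homomorphism of fields `F → L`. -/
noncomputable def coeffMap (φ : F →+* L) : RatFunc F →+* RatFunc L :=
  RatFunc.mapRingHom (Polynomial.mapRingHom φ)
    (nonZeroDivisors_le_comap_nonZeroDivisors_of_injective _
      (Polynomial.map_injective _ φ.injective))

@[simp]
theorem coeffMap_algebraMap (φ : F →+* L) (p : F[X]) :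
    coeffMap φ (algebraMap F[X] (RatFunc F) p) = algebraMap L[X] (RatFunc L) (p.map φ) := by
  have h := RatFunc.map_apply_div (Polynomial.mapRingHom φ)
    (nonZeroDivisors_le_comap_nonZeroDivisors_of_injective _
      (Polynomial.map_injective _ φ.injective)) p 1
  rw [map_one, map_one, map_one, div_one, div_one] at h
  exact h

@[simp]
theorem coeffMap_C (φ : F →+* L) (a : F) : coeffMap φ (RatFunc.C a) = RatFunc.C (φ a) := by
  rw [← RatFunc.algebraMap_C, coeffMap_algebraMap, Polynomial.map_C, RatFunc.algebraMap_C]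

@[simp]
theorem coeffMap_X (φ : F →+* L) : coeffMap φ RatFunc.X = RatFunc.X := by
  rw [← RatFunc.algebraMap_X, coeffMap_algebraMap, Polynomial.map_X, RatFunc.algebraMap_X]

theorem ratFunc_ringHom_ext {R : Type*} [CommRing R] {f g : RatFunc L →+* R}
    (hC : ∀ c, f (RatFunc.C c) = g (RatFunc.C c)) (hX : f RatFunc.X = g RatFunc.X) : f = g := by
  refine IsLocalization.ringHom_ext L[X]⁰ (Polynomial.ringHom_ext (fun c => ?_) ?_)
  · simpa using hC c
  · simpa using hX

theorem ratFuncMap_eq_coeffMap (K L : Type*) [Field K] [Field L] [Algebra K L] :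
    ratFuncMap K L = coeffMap (algebraMap K L) := rfl

end CoeffMap

/-! ### Galois action on rational functions -/

section Action

variable {K L : Type*} [Field K] [Field L] [Algebra K L]

/-- The action of `K`-automorphisms of `L` on the coefficients of rational functions. -/
noncomputable def coeffAction (K L : Type*) [Field K] [Field L] [Algebra K L] :
    (L ≃ₐ[K] L) →* (RatFunc L →+* RatFunc L) where
  toFun σ := coeffMap (σ : L →+* L)
  map_one' := ratFunc_ringHom_ext (fun c => by simp) (by simp)
  map_mul' σ τ := ratFunc_ringHom_ext (fun c => by simp) (by simp)

@[simp]
theorem coeffAction_C (σ : L ≃ₐ[K] L) (c : L) :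
    coeffAction K L σ (RatFunc.C c) = RatFunc.C (σ c) :=
  coeffMap_C _ c

@[simp]
theorem coeffAction_X (σ : L ≃ₐ[K] L) : coeffAction K L σ RatFunc.X = RatFunc.X :=
  coeffMap_X _

theorem coeffAction_algebraMap (σ : L ≃ₐ[K] L) (p : L[X]) :
    coeffAction K L σ (algebraMap L[X] (RatFunc L) p) =
      algebraMap L[X] (RatFunc L) (p.map (σ : L →+* L)) :=
  coeffMap_algebraMap _ p

@[simp]
theorem coeffAction_ratFuncMap (σ : L ≃ₐ[K] L) (y : RatFunc K) :
    coeffAction K L σ (ratFuncMap K L y) = ratFuncMap K L y := by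
  have : (coeffAction K L σ).comp (ratFuncMap K L) = ratFuncMap K L :=
    ratFunc_ringHom_ext (fun c => by simp [ratFuncMap_eq_coeffMap])
      (by simp [ratFuncMap_eq_coeffMap])
  exact RingHom.congr_fun this y

theorem coeffAction_inv_apply (σ : L ≃ₐ[K] L) (y : RatFunc L) :
    coeffAction K L σ⁻¹ (coeffAction K L σ y) = y := by
  have h : coeffAction K L σ⁻¹ * coeffAction K L σ = 1 := by
    rw [← map_mul, inv_mul_cancel, map_one]
  exact RingHom.congr_fun h y

theorem coeffAction_apply_inv (σ : L ≃ₐ[K] L) (y : RatFunc L) :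
    coeffAction K L σ (coeffAction K L σ⁻¹ y) = y := by
  simpa using coeffAction_inv_apply σ⁻¹ y

/-- A rational function fixed by all automorphisms is a quotient of polynomials with fixed
coefficients. -/
theorem coeff_fixed {f : RatFunc L} (hf : ∀ σ : L ≃ₐ[K] L, coeffAction K L σ f = f)
    (σ : L ≃ₐ[K] L) : f.num.map (σ : L →+* L) = f.num ∧ f.denom.map (σ : L →+* L) = f.denom := by
  have h := hf σ
  have hd : algebraMap L[X] (RatFunc L) f.denom ≠ 0 := RatFunc.algebraMap_ne_zero f.denom_ne_zero
  have hd' : f.denom.map (σ : L →+* L) ≠ 0 := (f.monic_denom.map _).ne_zero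
  have hdd : algebraMap L[X] (RatFunc L) (f.denom.map (σ : L →+* L)) ≠ 0 :=
    RatFunc.algebraMap_ne_zero hd'
  rw [← f.num_div_denom, map_div₀, coeffAction_algebraMap, coeffAction_algebraMap,
    div_eq_div_iff hdd hd, ← map_mul, ← map_mul] at h
  have h := RatFunc.algebraMap_injective L h
  -- The reduced form with monic denominator is unique: coprimality gives divisibility, and the
  -- degrees agree.
  have hdvd : f.denom ∣ f.denom.map (σ : L →+* L) :=
    f.isCoprime_num_denom.symm.dvd_of_dvd_mul_left ⟨_, by rw [← h, mul_comm]⟩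
  have hden : f.denom.map (σ : L →+* L) = f.denom :=
    Polynomial.eq_of_monic_of_dvd_of_natDegree_le f.monic_denom (f.monic_denom.map _) hdvd
      (by rw [Polynomial.natDegree_map])
  rw [hden] at h
  exact ⟨mul_right_cancel₀ f.denom_ne_zero h, hden⟩

end Action

/-! ### Conjugacy of valuation rings with equal trace -/

section Conjugate

variable {K L : Type*} [Field K] [Field L] [Algebra K L]

theorem pow_mem_valuationSubring_iff (U : ValuationSubring L) (x : L) {n : ℕ} (hn : n ≠ 0) :
    x ^ n ∈ U ↔ x ∈ U := by
  rw [← U.valuation_le_one_iff, ← U.valuation_le_one_iff, map_pow, pow_le_one_iff hn]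

theorem ringExpChar_pow_ne_zero (K : Type*) [Field K] (n : ℕ) : ringExpChar K ^ n ≠ 0 :=
  pow_ne_zero _ (expChar_pos K (ringExpChar K)).ne'

/-- A power of `x` with positive exponent lies in `K`, and membership of `x` in a valuation ring is
decided by that power. -/
theorem mem_iff_of_mem_perfectClosure {U₁ U₂ : ValuationSubring L}
    (h : U₁.comap (algebraMap K L) = U₂.comap (algebraMap K L)) {x : L}
    (hx : x ∈ perfectClosure K L) : x ∈ U₁ ↔ x ∈ U₂ := by
  obtain ⟨n, a, ha⟩ := mem_perfectClosure_iff.mp hx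
  have hn := ringExpChar_pow_ne_zero K n
  rw [← pow_mem_valuationSubring_iff U₁ x hn, ← pow_mem_valuationSubring_iff U₂ x hn, ← ha,
    ← ValuationSubring.mem_comap, h, ValuationSubring.mem_comap]

instance isGalois_perfectClosure [IsAlgClosure K L] : IsGalois (perfectClosure K L) L := by
  have := IsAlgClosure.isAlgClosed K (K := L)
  have : Algebra.IsAlgebraic K L := IsAlgClosure.isAlgebraic
  have : Algebra.IsAlgebraic (perfectClosure K L) L := Algebra.IsAlgebraic.tower_top (K := K) _
  have : IsAlgClosure (perfectClosure K L) L := ⟨inferInstance, inferInstance⟩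
  have : Normal (perfectClosure K L) L := IsAlgClosure.normal _ _
  exact ⟨⟩

theorem mem_perfectClosure_of_fixed [IsAlgClosure K L] {x : L}
    (hx : ∀ σ : L ≃ₐ[perfectClosure K L] L, σ x = x) : x ∈ perfectClosure K L := by
  obtain ⟨y, rfl⟩ := (InfiniteGalois.mem_range_algebraMap_iff_fixed x).mpr hx
  exact y.2

/-- Valuation rings of an algebraic closure with the same trace are conjugate. -/
theorem exists_algEquiv_mem_iff [IsAlgClosure K L] {U₁ U₂ : ValuationSubring L}
    (h : U₁.comap (algebraMap K L) = U₂.comap (algebraMap K L)) :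
    ∃ σ : L ≃ₐ[K] L, ∀ x, σ x ∈ U₂ ↔ x ∈ U₁ := by
  have : Algebra.IsAlgebraic (perfectClosure K L) L := inferInstance
  obtain ⟨σ, hσ⟩ := exists_smul_eq_of_fixed_mem_iff (G := L ≃ₐ[perfectClosure K L] L)
    (fun x => stabilizer_isOpen_of_isIntegral x) U₁ U₂
    fun x hx => mem_iff_of_mem_perfectClosure h (mem_perfectClosure_of_fixed hx)
  refine ⟨σ.restrictScalars K, fun x => ?_⟩
  rw [← hσ]
  exact ValuationSubring.smul_mem_pointwise_smul_iff (g := σ)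

/-- With `P` the perfect closure of `K` in `L`, the group `Gal(L/P)` acts on `L(X)` with open
stabilisers, and its fixed elements are purely inseparable over `K(X)`, where the two rings agree.
-/
theorem exists_coeffAction_mem_iff [IsAlgClosure K L] {W₁ W₂ : ValuationSubring (RatFunc L)}
    (h : W₁.comap (ratFuncMap K L) = W₂.comap (ratFuncMap K L)) :
    ∃ σ : L ≃ₐ[K] L, ∀ y, coeffAction K L σ y ∈ W₂ ↔ y ∈ W₁ := by
  have := IsAlgClosure.isAlgClosed K (K := L)
  let P := perfectClosure K L
  let _ : MulSemiringAction (L ≃ₐ[P] L) (RatFunc L) :=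
    MulSemiringAction.compHom (RatFunc L) (coeffAction P L)
  -- This fixes the meaning of `•` as the action on coefficients.
  let _ : SMul (L ≃ₐ[P] L) (RatFunc L) :=
    (MulSemiringAction.toDistribMulAction (M := L ≃ₐ[P] L) (R := RatFunc L)).toMulAction.toSMul
  let _ : Algebra (RatFunc K) (RatFunc L) := (ratFuncMap K L).toAlgebra
  have hsmul : ∀ (σ : L ≃ₐ[P] L) (y : RatFunc L), σ • y = coeffAction P L σ y := fun _ _ => rfl
  have hCmem : ∀ c ∈ P, RatFunc.C c ∈ perfectClosure (RatFunc K) (RatFunc L) := fun c hc => by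
    obtain ⟨n, a, ha⟩ := mem_perfectClosure_iff.mp hc
    have : ExpChar (RatFunc K) (ringExpChar K) :=
      expChar_of_injective_algebraMap (algebraMap K (RatFunc K)).injective _
    refine (mem_perfectClosure_iff_pow_mem (ringExpChar K)).mpr ⟨n, RatFunc.C a, ?_⟩
    rw [← map_pow, ← ha]
    exact coeffMap_C _ a
  have hXmem : (RatFunc.X : RatFunc L) ∈ perfectClosure (RatFunc K) (RatFunc L) := by
    have : (RatFunc.X : RatFunc L) = algebraMap (RatFunc K) (RatFunc L) RatFunc.X :=
      (coeffMap_X (algebraMap K L)).symm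
    rw [this]
    exact algebraMap_mem _ _
  have hpoly : ∀ p : L[X], (∀ σ : L ≃ₐ[P] L, p.map (σ : L →+* L) = p) →
      algebraMap L[X] (RatFunc L) p ∈ perfectClosure (RatFunc K) (RatFunc L) := fun p hp => by
    rw [p.as_sum_support_C_mul_X_pow, map_sum]
    refine sum_mem fun i _ => ?_
    rw [map_mul, map_pow, RatFunc.algebraMap_C, RatFunc.algebraMap_X]
    refine mul_mem (hCmem _ (mem_perfectClosure_of_fixed fun σ => ?_)) (pow_mem hXmem i)
    conv_rhs => rw [← hp σ]
    rw [Polynomial.coeff_map]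
    rfl
  have hC : ∀ c : L, IsOpen (MulAction.stabilizer (L ≃ₐ[P] L) (RatFunc.C c : RatFunc L) :
      Set (L ≃ₐ[P] L)) := fun c => by
    refine Subgroup.isOpen_mono (H₁ := MulAction.stabilizer (L ≃ₐ[P] L) c) (fun σ hσ => ?_)
      (stabilizer_isOpen_of_isIntegral c)
    rw [MulAction.mem_stabilizer_iff] at hσ ⊢
    rw [hsmul, coeffAction_C]
    exact congrArg _ hσ
  have hstab : ∀ y : RatFunc L, IsOpen (MulAction.stabilizer (L ≃ₐ[P] L) y :
      Set (L ≃ₐ[P] L)) := fun y => by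
    induction y using ratFunc_induction_linear with
    | hC c => exact hC c
    | hX a =>
      refine Subgroup.isOpen_mono (fun σ hσ => ?_) (hC a)
      rw [MulAction.mem_stabilizer_iff, hsmul] at hσ ⊢
      rw [map_sub, hσ, coeffAction_X]
    | hmul f g hf hg =>
      refine Subgroup.isOpen_mono (H₁ := MulAction.stabilizer _ f ⊓ MulAction.stabilizer _ g)
        (fun σ hσ => ?_) (hf.inter hg)
      obtain ⟨h1, h2⟩ := Subgroup.mem_inf.mp hσ
      rw [MulAction.mem_stabilizer_iff, hsmul] at h1 h2 ⊢
      rw [map_mul, h1, h2]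
    | hinv f hf =>
      refine Subgroup.isOpen_mono (fun σ hσ => ?_) hf
      rw [MulAction.mem_stabilizer_iff, hsmul] at hσ ⊢
      rw [map_inv₀, hσ]
  have hfix : ∀ y : RatFunc L, (∀ σ : L ≃ₐ[P] L, σ • y = y) → (y ∈ W₁ ↔ y ∈ W₂) := fun y hy => by
    refine mem_iff_of_mem_perfectClosure h ?_
    rw [← y.num_div_denom]
    exact div_mem (hpoly _ fun σ => (coeff_fixed hy σ).1) (hpoly _ fun σ => (coeff_fixed hy σ).2)
  obtain ⟨σ, hσ⟩ := exists_smul_eq_of_fixed_mem_iff hstab W₁ W₂ hfix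
  refine ⟨σ.restrictScalars K, fun y => ?_⟩
  rw [← hσ]
  exact ValuationSubring.smul_mem_pointwise_smul_iff (g := σ)

end Conjugate

/-! ### Extending valuation rings; algebraic extensions -/

section Extension

variable {F E : Type*} [Field F] [Field E]

/-- Every valuation ring of a field is the trace of a valuation ring of a given extension field. -/
theorem exists_comap_eq (φ : F →+* E) (W : ValuationSubring F) :
    ∃ W' : ValuationSubring E, W'.comap φ = W := by
  -- `A` dominates the image of `W`. If `φ x ∈ A` with `x ∉ W`, then `x⁻¹ ∈ W` becomes a unit in
  -- `A`, hence is one in `W`, which puts `x` in `W`.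
  obtain ⟨A, h, hloc⟩ := IsLocalRing.exists_factor_valuationRing (φ.comp W.subtype)
  refine ⟨A, SetLike.ext fun x => ⟨fun hx => ?_, fun hx => h ⟨x, hx⟩⟩⟩
  by_contra hxW
  have hx0 : x ≠ 0 := by rintro rfl; exact hxW (zero_mem _)
  have hinv : x⁻¹ ∈ W := (W.mem_or_inv_mem x).resolve_left hxW
  have hunit : IsUnit ((φ.comp W.subtype).codRestrict A.toSubring h ⟨x⁻¹, hinv⟩) :=
    isUnit_iff_exists_inv.mpr ⟨⟨φ x, hx⟩, Subtype.ext (by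
      change φ x⁻¹ * φ x = 1
      rw [← map_mul, inv_mul_cancel₀ hx0, map_one])⟩
  obtain ⟨y, hy⟩ := isUnit_iff_exists_inv.mp (hloc.map_nonunit _ hunit)
  have hy' : x⁻¹ * (y : F) = 1 := congrArg Subtype.val hy
  have : (y : F) = x := by rw [eq_inv_of_mul_eq_one_right hy', inv_inv]
  exact hxW (this ▸ y.2)

theorem comap_valuation_isEquiv (φ : F →+* E) (W : ValuationSubring E) :
    (W.comap φ).valuation.IsEquiv (W.valuation.comap φ) :=
  Valuation.isEquiv_iff_val_le_one.mpr fun {x} => by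
    rw [ValuationSubring.valuation_le_one_iff, ValuationSubring.mem_comap, Valuation.comap_apply,
      ValuationSubring.valuation_le_one_iff]

theorem comap_valuation_eq_one_iff (φ : F →+* E) (W : ValuationSubring E) (x : F) :
    (W.comap φ).valuation x = 1 ↔ W.valuation (φ x) = 1 :=
  (Valuation.isEquiv_iff_val_eq_one.mp (comap_valuation_isEquiv φ W))

/-- Value groups of algebraic extensions are torsion modulo the value group of the base field. -/
theorem exists_pow_eq_valuation {Γ : Type*} [LinearOrderedCommGroupWithZero Γ] [Algebra F E]
    [Algebra.IsAlgebraic F E] (v : Valuation E Γ) {c : E} (hc : c ≠ 0) :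
    ∃ n : ℕ, 0 < n ∧ ∃ a : F, v c ^ n = v (algebraMap F E a) := by
  obtain ⟨p, hp, hpc⟩ := Algebra.IsAlgebraic.isAlgebraic (R := F) c
  have hcoeff : ∀ i ∈ p.support, v (algebraMap F E (p.coeff i)) ≠ 0 := fun i hi => by
    simpa using Polynomial.mem_support_iff.mp hi
  have hvc : v c ≠ 0 := by simpa using hc
  obtain ⟨i, hi, himax⟩ := p.support.exists_max_image
    (fun i => v (algebraMap F E (p.coeff i) * c ^ i)) (Polynomial.support_nonempty.mpr hp)
  have hi0 : v (algebraMap F E (p.coeff i) * c ^ i) ≠ 0 := by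
    rw [map_mul, map_pow]
    exact mul_ne_zero (hcoeff i hi) (pow_ne_zero _ hvc)
  -- In a vanishing sum the maximal value is attained at least twice. Comparing two such terms gives
  -- a power of `c` with a value from `F`.
  obtain ⟨j, hj, hji, hval⟩ : ∃ j ∈ p.support, j ≠ i ∧
      v (algebraMap F E (p.coeff j) * c ^ j) = v (algebraMap F E (p.coeff i) * c ^ i) := by
    by_contra! hne
    rw [Polynomial.aeval_def, Polynomial.eval₂_eq_sum, Polynomial.sum_def,
      ← Finset.add_sum_erase _ _ hi] at hpc
    refine hi0 ?_
    rw [← v.map_add_eq_of_lt_left, hpc, map_zero]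
    refine v.map_sum_lt hi0 fun j hj => ?_
    obtain ⟨hji, hj⟩ := Finset.mem_erase.mp hj
    exact lt_of_le_of_ne (himax j hj) (hne j hj hji)
  have key : ∀ {j k : ℕ}, j ∈ p.support → k ∈ p.support → j < k →
      v (algebraMap F E (p.coeff j) * c ^ j) = v (algebraMap F E (p.coeff k) * c ^ k) →
      ∃ n : ℕ, 0 < n ∧ ∃ a : F, v c ^ n = v (algebraMap F E a) := by
    intro j k hj hk hjk h
    refine ⟨k - j, by omega, p.coeff j / p.coeff k, ?_⟩
    rw [map_mul, map_mul, map_pow, map_pow, show k = (k - j) + j by omega, pow_add, ← mul_assoc,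
      Nat.sub_add_cancel hjk.le] at h
    have h' := mul_right_cancel₀ (pow_ne_zero j hvc) h
    rw [map_div₀, map_div₀, h', mul_div_cancel_left₀ _ (hcoeff k hk)]
  rcases lt_or_gt_of_ne hji with h | h
  · exact key hj hi h hval
  · exact key hi hj h hval.symm

/-- Polynomials with integral coefficients respect congruence modulo the maximal ideal. -/
theorem valuation_sum_sub_lt {Γ : Type*} [LinearOrderedCommGroupWithZero Γ] (w : Valuation E Γ)
    {t c : E} (ht : w t ≤ 1) (hc : w c ≤ 1) (htc : w (t - c) < 1) {a : ℕ → E}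
    (ha : ∀ i, w (a i) ≤ 1) (s : Finset ℕ) :
    w (∑ i ∈ s, a i * t ^ i - ∑ i ∈ s, a i * c ^ i) < 1 := by
  rw [← Finset.sum_sub_distrib]
  refine w.map_sum_lt one_ne_zero fun i hi => ?_
  clear hi
  rw [← mul_sub, map_mul]
  refine (mul_le_of_le_one_left' (ha i)).trans_lt ?_
  induction i with
  | zero => simp
  | succ i ih =>
    rw [show t ^ (i + 1) - c ^ (i + 1) = t * (t ^ i - c ^ i) + (t - c) * c ^ i by ring]
    refine w.map_add_lt ?_ ?_
    · rw [map_mul]; exact (mul_le_of_le_one_left' ht).trans_lt ih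
    · rw [map_mul, map_pow]; exact (mul_le_of_le_one_right' (pow_le_one' hc i)).trans_lt htc

end Extension

/-! ### Residual transcendence -/

section Residue

variable {K L : Type*} [Field K] [Field L] [Algebra K L]

theorem residue_ne_zero_iff {F : Type*} [Field F] (V : ValuationSubring F) (x : V) :
    IsLocalRing.residue V x ≠ 0 ↔ V.valuation (x : F) = 1 := by
  rw [IsLocalRing.residue_ne_zero_iff_isUnit, V.valuation_eq_one_iff]

theorem aeval_residue {V : ValuationSubring K} {W : ValuationSubring (RatFunc K)}
    (h : W.comap (algebraMap K (RatFunc K)) = V) (q : V[X]) (t : W) :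
    (q.map (IsLocalRing.residue V)).eval₂ (residueMap V W h) (IsLocalRing.residue W t) ≠ 0 ↔
      W.valuation (Polynomial.aeval (t : RatFunc K) (q.map V.subtype)) = 1 := by
  have h1 : (residueMap V W h).comp (IsLocalRing.residue V) =
      (IsLocalRing.residue W).comp (inclusionOfComap V W h) := rfl
  have h2 : W.subtype.comp (inclusionOfComap V W h) =
      (algebraMap K (RatFunc K)).comp V.subtype := rfl
  rw [Polynomial.eval₂_map, h1, ← Polynomial.hom_eval₂, residue_ne_zero_iff,
    Polynomial.aeval_def, Polynomial.eval₂_map, ← h2]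
  have h3 := Polynomial.hom_eval₂ q (inclusionOfComap V W h) W.subtype t
  exact Iff.of_eq (congrArg (W.valuation · = 1) h3)

/-- Residual transcendence without residue fields: some `t ∈ W` maps every primitive polynomial
over `V` to a unit of `W`. -/
theorem isResiduallyTranscendental_iff {V : ValuationSubring K} {W : ValuationSubring (RatFunc K)} :
    IsResiduallyTranscendental V W ↔ W.comap (algebraMap K (RatFunc K)) = V ∧
      ∃ t ∈ W, ∀ p : K[X], (∀ i, V.valuation (p.coeff i) ≤ 1) →
        (∃ i, V.valuation (p.coeff i) = 1) → W.valuation (Polynomial.aeval t p) = 1 := by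
  constructor
  · rintro ⟨h, htr⟩
    refine ⟨h, ?_⟩
    let _ := (residueMap V W h).toAlgebra
    obtain ⟨x, hx⟩ := htr
    obtain ⟨t, rfl⟩ := IsLocalRing.residue_surjective x
    refine ⟨t, t.2, fun p hp hp1 => ?_⟩
    have hlift : p ∈ Polynomial.lifts V.subtype := (Polynomial.lifts_iff_coeff_lifts p).mpr
      fun i => ⟨⟨p.coeff i, (V.valuation_le_one_iff _).mp (hp i)⟩, rfl⟩
    obtain ⟨q, rfl⟩ := (Polynomial.mem_lifts p).mp hlift
    refine (aeval_residue h q t).mp fun h0 => ?_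
    have hq0 := transcendental_iff.mp hx _ h0
    obtain ⟨i, hi⟩ := hp1
    rw [Polynomial.coeff_map] at hi
    refine (residue_ne_zero_iff V (q.coeff i)).mpr hi ?_
    rw [← Polynomial.coeff_map, hq0, Polynomial.coeff_zero]
  · rintro ⟨h, t, ht, htp⟩
    refine ⟨h, ?_⟩
    let _ := (residueMap V W h).toAlgebra
    refine ⟨IsLocalRing.residue W ⟨t, ht⟩, transcendental_iff.mpr fun p hp => ?_⟩
    obtain ⟨q, rfl⟩ := Polynomial.map_surjective _ IsLocalRing.residue_surjective p
    by_contra hq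
    obtain ⟨i, hi⟩ : ∃ i, (q.map (IsLocalRing.residue V)).coeff i ≠ 0 := by
      by_contra! hall
      exact hq (Polynomial.ext fun i => by rw [hall, Polynomial.coeff_zero])
    rw [Polynomial.coeff_map, residue_ne_zero_iff] at hi
    refine (aeval_residue h q ⟨t, ht⟩).mpr (htp _ (fun i => ?_) ⟨i, ?_⟩) hp
    · rw [Polynomial.coeff_map]
      exact (V.valuation_le_one_iff _).mpr (q.coeff i).2
    · rw [Polynomial.coeff_map]
      exact hi

variable {V : ValuationSubring K} {U : ValuationSubring L} {W : ValuationSubring (RatFunc L)}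

theorem comap_ratFuncMap_comap (hW : W.comap RatFunc.C = U)
    (hU : U.comap (algebraMap K L) = V) :
    (W.comap (ratFuncMap K L)).comap (algebraMap K (RatFunc K)) = V := by
  ext a
  rw [ValuationSubring.mem_comap, ValuationSubring.mem_comap, RatFunc.algebraMap_eq_C,
    ratFuncMap_eq_coeffMap, coeffMap_C, ← ValuationSubring.mem_comap, hW, ← hU,
    ValuationSubring.mem_comap]

theorem valuation_C_le_one_iff (hW : W.comap RatFunc.C = U) (c : L) :
    W.valuation (RatFunc.C c) ≤ 1 ↔ c ∈ U := by
  rw [W.valuation_le_one_iff, ← ValuationSubring.mem_comap, hW]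

theorem ratFuncMap_aeval (t : RatFunc K) (p : K[X]) :
    ratFuncMap K L (Polynomial.aeval t p) =
      (p.map (algebraMap K L)).eval₂ RatFunc.C (ratFuncMap K L t) := by
  rw [Polynomial.aeval_def, Polynomial.hom_eval₂, Polynomial.eval₂_map]
  congr 1
  ext a
  simp [RatFunc.algebraMap_eq_C, ratFuncMap_eq_coeffMap]

/-- A residue transcendental over that of `V` differs from every residue of `U`, which is algebraic.
Concretely, a primitive `q` over `V` killing `c` would give `q(t) ≡ q(c) = 0`, while `q(t)` is a
unit. -/
theorem valuation_sub_C_eq_one [Algebra.IsAlgebraic K L] (hW : W.comap RatFunc.C = U)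
    (hU : U.comap (algebraMap K L) = V)
    {t : RatFunc K} (ht : t ∈ W.comap (ratFuncMap K L))
    (htp : ∀ p : K[X], (∀ i, V.valuation (p.coeff i) ≤ 1) → (∃ i, V.valuation (p.coeff i) = 1) →
      (W.comap (ratFuncMap K L)).valuation (Polynomial.aeval t p) = 1) {c : L} (hc : c ∈ U) :
    W.valuation (ratFuncMap K L t - RatFunc.C c) = 1 := by
  have ht1 : W.valuation (ratFuncMap K L t) ≤ 1 := (W.valuation_le_one_iff _).mpr ht
  have hc1 := (valuation_C_le_one_iff hW c).mpr hc
  refine le_antisymm ((W.valuation.map_sub _ _).trans (max_le ht1 hc1)) (not_lt.mp fun hlt => ?_)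
  obtain ⟨p, hp, hpc⟩ := Algebra.IsAlgebraic.isAlgebraic (R := K) c
  obtain ⟨k, hk, hkle, -⟩ := exists_max_coeff V.valuation hp
  have hk0 : 0 < V.valuation (p.coeff k) := zero_lt_iff.mpr (by simpa using hk)
  set q := Polynomial.C (p.coeff k)⁻¹ * p with hq
  have hqi : ∀ i, V.valuation (q.coeff i) = V.valuation (p.coeff i) / V.valuation (p.coeff k) :=
    fun i => by rw [hq, Polynomial.coeff_C_mul, map_mul, map_inv₀, div_eq_inv_mul]
  have hq1 : ∀ i, V.valuation (q.coeff i) ≤ 1 := fun i => by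
    rw [hqi]; exact div_le_one_of_le₀ (hkle i) zero_le
  have h1 := htp q hq1 ⟨k, by rw [hqi, div_self hk0.ne']⟩
  rw [comap_valuation_eq_one_iff, ratFuncMap_aeval, Polynomial.eval₂_eq_sum] at h1
  have hqc : (q.map (algebraMap K L)).eval₂ RatFunc.C (RatFunc.C c) = 0 := by
    rw [Polynomial.eval₂_hom, Polynomial.eval_map_algebraMap, hq, map_mul, hpc, mul_zero, map_zero]
  rw [Polynomial.eval₂_eq_sum] at hqc
  have h2 := valuation_sum_sub_lt W.valuation ht1 hc1 hlt
    (a := fun i => RatFunc.C ((q.map (algebraMap K L)).coeff i))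
    (fun i => by
      rw [valuation_C_le_one_iff hW, Polynomial.coeff_map, ← ValuationSubring.mem_comap, hU,
        ← V.valuation_le_one_iff]
      exact hq1 i) (q.map (algebraMap K L)).support
  rw [Polynomial.sum_def] at h1 hqc
  rw [hqc, sub_zero, h1] at h2
  exact lt_irrefl _ h2

/-- The hypothesis gives `t - a` the value `max 1 (u a)` for every `a`. So `p ↦ p(t)` pulls the
valuation back to the Gauss valuation on linear factors, hence on all polynomials, and primitive
ones have value `1`. -/
theorem isResiduallyTranscendental_comap [IsAlgClosed L] (hW : W.comap RatFunc.C = U)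
    (hU : U.comap (algebraMap K L) = V) {t : RatFunc K}
    (ht : ∀ c ∈ U, W.valuation (ratFuncMap K L t - RatFunc.C c) = 1) :
    IsResiduallyTranscendental V (W.comap (ratFuncMap K L)) := by
  have ht1 : W.valuation (ratFuncMap K L t) = 1 := by simpa using ht 0 (zero_mem U)
  refine isResiduallyTranscendental_iff.mpr ⟨comap_ratFuncMap_comap hW hU, t,
    (W.valuation_le_one_iff _).mp ht1.le, fun p hp hp1 => ?_⟩
  rw [comap_valuation_eq_one_iff, ratFuncMap_aeval]
  let u := W.valuation.comap (RatFunc.C : L →+* RatFunc L)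
  have heq : W.valuation.comap (Polynomial.eval₂RingHom RatFunc.C (ratFuncMap K L t))
      (p.map (algebraMap K L)) = gaussValuation u 1 (p.map (algebraMap K L)) := by
    refine polynomial_valuation_ext (fun c => ?_) (fun a => ?_) _
    · exact (by simp [u] : _ = u c).trans (gaussFun_C u _ c).symm
    · have h1 : gaussValuation u 1 (Polynomial.X - Polynomial.C a) = max 1 (u a) := by
        have := gaussFun_X_add_C u 1 (-a)
        rwa [map_neg, ← sub_eq_add_neg, Valuation.map_neg] at this
      rw [h1]
      simp only [Valuation.comap_apply, Polynomial.coe_eval₂RingHom, Polynomial.eval₂_sub,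
        Polynomial.eval₂_X, Polynomial.eval₂_C, u]
      by_cases ha : a ∈ U
      · rw [ht a ha, max_eq_left ((valuation_C_le_one_iff hW a).mpr ha)]
      · have ha1 : 1 < W.valuation (RatFunc.C a) :=
          not_le.mp fun h => ha ((valuation_C_le_one_iff hW a).mp h)
        rw [max_eq_right ha1.le, W.valuation.map_sub_eq_of_lt_right (by rwa [ht1])]
  refine heq.trans (le_antisymm (gaussFun_le fun i => ?_) ?_)
  · rw [Units.val_one, one_pow, mul_one, Polynomial.coeff_map]
    refine (valuation_C_le_one_iff hW _).mpr ?_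
    rw [← ValuationSubring.mem_comap, hU, ← V.valuation_le_one_iff]
    exact hp i
  · obtain ⟨i, hi⟩ := hp1
    refine le_trans ?_ (le_gaussFun u _ _ i)
    rw [Units.val_one, one_pow, mul_one, Polynomial.coeff_map]
    subst hU
    rw [comap_valuation_eq_one_iff] at hi
    subst hW
    rw [comap_valuation_eq_one_iff] at hi
    exact hi.ge

end Residue

/-! ### Balls and monomial rings -/

section Balls

variable {L : Type*} [Field L] {U : ValuationSubring L}

theorem exists_valuation_eq (U : ValuationSubring L) (ρ : U.ValueGroupˣ) :
    ∃ d : L, d ≠ 0 ∧ U.valuation d = ρ := by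
  obtain ⟨d, hd⟩ := U.valuation_surjective (ρ : U.ValueGroup)
  refine ⟨d, ?_, hd⟩
  rintro rfl
  exact ρ.ne_zero (by simpa using hd.symm)

theorem mem_ball {α x : L} {ρ : U.ValueGroupˣ} : x ∈ ball U α ρ ↔ U.valuation (x - α) ≤ ρ :=
  Iff.rfl

theorem ball_subset_iff {α β : L} {ρ τ : U.ValueGroupˣ} :
    ball U α ρ ⊆ ball U β τ ↔ (ρ : U.ValueGroup) ≤ τ ∧ U.valuation (α - β) ≤ τ := by
  refine ⟨fun h => ?_, fun ⟨h1, h2⟩ x hx => ?_⟩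
  · have hα : U.valuation (α - β) ≤ τ := h (mem_ball.mpr (by simp))
    -- The points `α` and `α + d`, with `d` of value exactly `ρ`, test both conditions.
    obtain ⟨d, -, hd⟩ := exists_valuation_eq U ρ
    have hd' : U.valuation (α + d - β) ≤ τ := h (mem_ball.mpr (by simp [hd]))
    refine ⟨?_, hα⟩
    rw [← hd, show d = (α + d - β) - (α - β) by ring]
    exact (U.valuation.map_sub _ _).trans (max_le hd' hα)
  · rw [mem_ball] at hx ⊢
    rw [show x - β = (x - α) + (α - β) by ring]
    exact (U.valuation.map_add _ _).trans (max_le (hx.trans h1) h2)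

theorem mem_monomialRing {α : L} {ρ : U.ValueGroupˣ} {y : RatFunc L} :
    y ∈ monomialRing U α ρ ↔ monomialValuationRat U.valuation α ρ y ≤ 1 :=
  Iff.rfl

theorem monomialRing_comap_C (α : L) (ρ : U.ValueGroupˣ) :
    (monomialRing U α ρ).comap RatFunc.C = U := by
  ext c
  rw [ValuationSubring.mem_comap, mem_monomialRing, monomialValuationRat_C,
    U.valuation_le_one_iff]

theorem monomialRing_valuation_eq_one_iff {α : L} {ρ : U.ValueGroupˣ} (y : RatFunc L) :
    (monomialRing U α ρ).valuation y = 1 ↔ monomialValuationRat U.valuation α ρ y = 1 :=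
  (Valuation.isEquiv_iff_val_eq_one.mp
    (monomialValuationRat U.valuation α ρ).isEquiv_valuation_valuationSubring).symm

/-- The value group of `w` is arbitrary, so that `w` can be the canonical valuation of `W`, another
monomial valuation or a conjugate of one. -/
theorem eq_monomialRing [IsAlgClosed L] {W : ValuationSubring (RatFunc L)} (hW : W.comap RatFunc.C = U) {α d : L}
    {ρ : U.ValueGroupˣ} (hd : U.valuation d = ρ) {Γ : Type*} [LinearOrderedCommGroupWithZero Γ]
    {w : Valuation (RatFunc L) Γ} (hw : ∀ y, w y ≤ 1 ↔ y ∈ W) (hmon : IsMonomial w α d) :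
    W = monomialRing U α ρ := by
  ext y
  rw [← hw, mem_monomialRing]
  refine hmon.le_one_iff (isMonomial_monomialValuationRat U.valuation α hd) (fun c => ?_) y
  rw [hw, monomialValuationRat_C, U.valuation_le_one_iff, ← ValuationSubring.mem_comap, hW]

/-- The test element is `(X - α) / d` with `d` of value `ρ`: its membership in the second ring says
`max τ (u (β - α)) ≤ ρ`. -/
theorem ball_subset_of_monomialRing_le {α β : L} {ρ τ : U.ValueGroupˣ}
    (h : monomialRing U α ρ ≤ monomialRing U β τ) : ball U β τ ⊆ ball U α ρ := by
  obtain ⟨d, hd0, hd⟩ := exists_valuation_eq U ρ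
  have hρ : 0 < (ρ : U.ValueGroup) := zero_lt_iff.mpr ρ.ne_zero
  have h1 : (RatFunc.X - RatFunc.C α) / RatFunc.C d ∈ monomialRing U α ρ := by
    rw [mem_monomialRing, map_div₀, monomialValuationRat_X_sub_C, monomialValuationRat_C, hd,
      sub_self, map_zero, max_eq_left zero_le, div_self ρ.ne_zero]
  have h2 := h h1
  rw [mem_monomialRing, map_div₀, monomialValuationRat_X_sub_C, monomialValuationRat_C, hd,
    div_le_one₀ hρ, max_le_iff] at h2
  exact ball_subset_iff.mpr h2

/-- The ring of a monomial valuation is determined by its ball, and conversely. -/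
theorem monomialRing_eq_iff [IsAlgClosed L] {α β : L} {ρ τ : U.ValueGroupˣ} :
    monomialRing U α ρ = monomialRing U β τ ↔ ball U α ρ = ball U β τ := by
  refine ⟨fun h => (ball_subset_of_monomialRing_le h.ge).antisymm
    (ball_subset_of_monomialRing_le h.le), fun h => ?_⟩
  obtain ⟨h1, h2⟩ := ball_subset_iff.mp h.le
  obtain ⟨h3, h4⟩ := ball_subset_iff.mp h.ge
  obtain rfl : ρ = τ := Units.ext (h1.antisymm h3)
  obtain ⟨d, -, hd⟩ := exists_valuation_eq U ρ
  refine eq_monomialRing (monomialRing_comap_C α ρ) (d := d) hd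
    (w := monomialValuationRat U.valuation α ρ) (fun y => mem_monomialRing.symm) fun a => ?_
  rw [monomialValuationRat_X_sub_C, monomialValuationRat_C, monomialValuationRat_C, hd]
  refine le_antisymm (max_le (le_max_left _ _) ?_) (max_le (le_max_left _ _) ?_)
  · rw [show α - a = (α - β) + (β - a) by ring]
    exact (U.valuation.map_add _ _).trans (max_le_max_right _ h2)
  · rw [show β - a = (β - α) + (α - a) by ring]
    exact (U.valuation.map_add _ _).trans (max_le_max_right _ h4)

end Balls

/-! ### Decomposition group and traces on `K(X)` -/

section Decomposition

variable {K L : Type*} [Field K] [Field L] [Algebra K L] {U : ValuationSubring L}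

theorem mem_decompositionSubgroup_iff {σ : L ≃ₐ[K] L} :
    σ ∈ U.decompositionSubgroup K ↔ ∀ x, σ x ∈ U ↔ x ∈ U := by
  rw [ValuationSubring.decompositionSubgroup, MulAction.mem_stabilizer_iff]
  refine ⟨fun h x => ?_, fun h => SetLike.ext fun x => ?_⟩
  · have h' := ValuationSubring.smul_mem_pointwise_smul_iff (g := σ) (S := U) (x := x)
    rwa [h] at h'
  · obtain ⟨y, rfl⟩ := σ.surjective x
    exact ValuationSubring.smul_mem_pointwise_smul_iff.trans (h y).symm

theorem valuation_comap_isEquiv {σ : L ≃ₐ[K] L} (hσ : ∀ x, σ x ∈ U ↔ x ∈ U) :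
    (U.valuation.comap (σ : L →+* L)).IsEquiv U.valuation :=
  Valuation.isEquiv_iff_val_le_one.mpr fun {x} => by
    rw [Valuation.comap_apply, U.valuation_le_one_iff, U.valuation_le_one_iff]
    exact hσ x

/-- Only the equivalence of `u ∘ σ` and `u` is used. Carrying the radius as the value of `σ d`
avoids proving `τ = ρ`. -/
theorem smul_ball {σ : L ≃ₐ[K] L} (hσ : ∀ x, σ x ∈ U ↔ x ∈ U) {α d : L} {ρ τ : U.ValueGroupˣ}
    (hρ : U.valuation d = ρ) (hτ : U.valuation (σ d) = τ) :
    σ • ball U α ρ = ball U (σ α) τ := by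
  ext x
  obtain ⟨y, rfl⟩ := σ.surjective x
  rw [show σ y = σ • y from rfl, Set.smul_mem_smul_set_iff, mem_ball, mem_ball, ← hρ, ← hτ,
    AlgEquiv.smul_def, ← map_sub]
  exact (valuation_comap_isEquiv hσ (y - α) d).symm

theorem coeffAction_mem_monomialRing_iff [IsAlgClosed L] {σ : L ≃ₐ[K] L}
    (hσ : ∀ x, σ x ∈ U ↔ x ∈ U) {α d : L} {ρ τ : U.ValueGroupˣ}
    (hρ : U.valuation d = ρ) (hτ : U.valuation (σ d) = τ) (y : RatFunc L) :
    coeffAction K L σ y ∈ monomialRing U (σ α) τ ↔ y ∈ monomialRing U α ρ := by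
  rw [← ValuationSubring.mem_comap, ← eq_monomialRing (α := α) (d := d) (U := U)
    (W := (monomialRing U (σ α) τ).comap (coeffAction K L σ)) ?_ hρ
    (w := (monomialValuationRat U.valuation (σ α) τ).comap (coeffAction K L σ))
    (fun y => Iff.rfl) fun a => ?_]
  · ext c
    rw [ValuationSubring.mem_comap, ValuationSubring.mem_comap, coeffAction_C,
      ← ValuationSubring.mem_comap, monomialRing_comap_C, hσ]
  · simp only [Valuation.comap_apply, map_sub (coeffAction K L σ), coeffAction_C, coeffAction_X,
      monomialValuationRat_X_sub_C, monomialValuationRat_C, hτ, map_sub σ]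

variable {V : ValuationSubring K}

/-- The element `t = fⁿ / a` has value `1`, and `fⁿ` has no constant term in its expansion at `α`.
Subtracting `r ∈ U` therefore leaves the value `max 1 (u r) = 1`. -/
theorem isResiduallyTranscendental_monomialRing [IsAlgClosure K L]
    (hU : U.comap (algebraMap K L) = V) (α : L) (ρ : U.ValueGroupˣ) :
    IsResiduallyTranscendental V ((monomialRing U α ρ).comap (ratFuncMap K L)) := by
  have := IsAlgClosure.isAlgClosed K (K := L)
  have : Algebra.IsAlgebraic K L := IsAlgClosure.isAlgebraic
  obtain ⟨f, hf, hfα⟩ := Algebra.IsAlgebraic.isAlgebraic (R := K) α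
  set g : L[X] := f.map (algebraMap K L) with hg
  have hg0 : g ≠ 0 := (Polynomial.map_ne_zero_iff (algebraMap K L).injective).mpr hf
  have hgα : g.eval α = 0 := by rw [hg, Polynomial.eval_map_algebraMap, hfα]
  set μ := monomialValuationRat U.valuation α ρ with hμ
  have hμg : μ (algebraMap L[X] (RatFunc L) g) ≠ 0 := by
    simpa using hg0
  obtain ⟨c, hc⟩ := U.valuation_surjective (μ (algebraMap L[X] (RatFunc L) g))
  have hc0 : c ≠ 0 := by
    rintro rfl
    exact hμg (by rw [← hc, map_zero])
  -- The value of `f` is that of some `c` in `L`; a power of it comes from `K`, so that `t` can be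
  -- formed in `K(X)`.
  obtain ⟨n, hn, a, ha⟩ := exists_pow_eq_valuation (F := K) U.valuation hc0
  have ha0 : U.valuation (algebraMap K L a) ≠ 0 := by
    rw [← ha, hc]; exact pow_ne_zero _ hμg
  have haL : algebraMap K L a ≠ 0 := by simpa using ha0
  refine isResiduallyTranscendental_comap (monomialRing_comap_C α ρ) hU
    (t := algebraMap K[X] (RatFunc K) (f ^ n) / RatFunc.C a) fun r hr => ?_
  rw [monomialRing_valuation_eq_one_iff]
  have hC : (RatFunc.C (algebraMap K L a) : RatFunc L) ≠ 0 := by simpa using haL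
  have h1 : ratFuncMap K L (algebraMap K[X] (RatFunc K) (f ^ n) / RatFunc.C a) - RatFunc.C r =
      algebraMap L[X] (RatFunc L) (g ^ n - Polynomial.C (algebraMap K L a * r)) /
        RatFunc.C (algebraMap K L a) := by
    rw [map_div₀, ratFuncMap_eq_coeffMap, coeffMap_algebraMap, coeffMap_C, Polynomial.map_pow,
      ← hg, map_sub, RatFunc.algebraMap_C, map_mul]
    field_simp
  have h2 : (Polynomial.taylor α (g ^ n)).coeff 0 = 0 := by
    rw [Polynomial.taylor_coeff_zero, Polynomial.eval_pow, hgα, zero_pow hn.ne']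
  rw [h1, map_div₀, monomialValuationRat_C, monomialValuationRat_algebraMap, map_sub,
    Polynomial.taylor_C, gaussFun_sub_C _ _ h2, ← monomialValuationRat_algebraMap, map_pow, map_pow,
    ← hμ, ← hc, ha, map_mul, max_eq_left, div_self ha0]
  exact mul_le_of_le_one_right' ((U.valuation_le_one_iff r).mpr hr)

/-- Every residually transcendental extension is the trace of a monomial valuation ring. -/
theorem exists_eq_comap_monomialRing [IsAlgClosure K L] (hU : U.comap (algebraMap K L) = V)
    {W : ValuationSubring (RatFunc K)} (hW : IsResiduallyTranscendental V W) :
    ∃ (α : L) (ρ : U.ValueGroupˣ), ρ ∈ hull K U ∧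
      (monomialRing U α ρ).comap (ratFuncMap K L) = W := by
  have := IsAlgClosure.isAlgClosed K (K := L)
  have : Algebra.IsAlgebraic K L := IsAlgClosure.isAlgebraic
  obtain ⟨hWV, t, ht, htp⟩ := isResiduallyTranscendental_iff.mp hW
  obtain ⟨W₁, rfl⟩ := exists_comap_eq (ratFuncMap K L) W
  have hUV : U.comap (algebraMap K L) =
      (W₁.comap (RatFunc.C : L →+* RatFunc L)).comap (algebraMap K L) := by
    rw [hU, ← hWV]
    ext a
    simp [ratFuncMap_eq_coeffMap, RatFunc.algebraMap_eq_C]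
  -- The trace of `W₁` on `L` is only conjugate to `U`. Pulling `W₁` back along `σ` corrects this
  -- without changing the trace on `K(X)`.
  obtain ⟨σ, hσ⟩ := exists_algEquiv_mem_iff hUV
  set W₂ := W₁.comap (coeffAction K L σ) with hW₂
  have hW₁₂ : W₁.comap (ratFuncMap K L) = W₂.comap (ratFuncMap K L) := by
    ext y
    rw [ValuationSubring.mem_comap, ValuationSubring.mem_comap, hW₂, ValuationSubring.mem_comap,
      coeffAction_ratFuncMap]
  have hW₂C : W₂.comap RatFunc.C = U := by
    ext c
    rw [ValuationSubring.mem_comap, hW₂, ValuationSubring.mem_comap, coeffAction_C, ← hσ,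
      ValuationSubring.mem_comap]
  rw [hW₁₂] at ht htp ⊢
  obtain ⟨α, d, hd, hmon⟩ := exists_isMonomial (w := W₂.valuation) (t := ratFuncMap K L t)
    fun c hc => valuation_sub_C_eq_one hW₂C hU ht htp ((valuation_C_le_one_iff hW₂C c).mp hc)
  have hd' : U.valuation d ≠ 0 := by simpa using hd
  refine ⟨α, Units.mk0 _ hd', exists_pow_eq_valuation (F := K) U.valuation hd, ?_⟩
  rw [← eq_monomialRing hW₂C (ρ := Units.mk0 _ hd') rfl (W₂.valuation_le_one_iff) hmon]

end Decomposition

end RTExt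

/-! ### The bijection -/

theorem mainTheorem10 {K : Type*} {Kbar : Type*} [Field K] [Field Kbar] [Algebra K Kbar]
    [IsAlgClosure K Kbar] (V : ValuationSubring K) (U : ValuationSubring Kbar)
    (hU : U.comap (algebraMap K Kbar) = V) :
    ∃ Θ : MulAction.orbitRel.Quotient (U.decompositionSubgroup K) (RTExt.balls K U) →
        {W : ValuationSubring (RatFunc K) // RTExt.IsResiduallyTranscendental V W},
      (∀ (α : Kbar) (ρ : RTExt.hull K U),
        (Θ (Quotient.mk _ (RTExt.mkBall U α ρ)) : ValuationSubring (RatFunc K)) =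
          (RTExt.monomialRing U α ρ).comap (RTExt.ratFuncMap K Kbar)) ∧
      Function.Bijective Θ := by
  open RTExt in
  have := IsAlgClosure.isAlgClosed K (K := Kbar)
  have hball : ∀ B : balls K U, ∃ (α : Kbar) (ρ : hull K U), B = mkBall U α ρ := by
    rintro ⟨B, α, ρ, hρ, rfl⟩
    exact ⟨α, ⟨ρ, hρ⟩, rfl⟩
  choose cen rad hcr using hball
  have hsmul : ∀ (σ : Kbar ≃ₐ[K] Kbar), (∀ x, σ x ∈ U ↔ x ∈ U) → ∀ (α : Kbar) (ρ : U.ValueGroupˣ),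
      ∃ τ : U.ValueGroupˣ, σ • ball U α ρ = ball U (σ α) τ ∧
        ∀ y, coeffAction K Kbar σ y ∈ monomialRing U (σ α) τ ↔ y ∈ monomialRing U α ρ := by
    intro σ hσ α ρ
    obtain ⟨d, hd0, hd⟩ := exists_valuation_eq U ρ
    have hσd : U.valuation (σ d) ≠ 0 := by simpa using hd0
    exact ⟨Units.mk0 _ hσd, smul_ball hσ hd rfl, coeffAction_mem_monomialRing_iff hσ hd rfl⟩
  let f : balls K U → {W : ValuationSubring (RatFunc K) // IsResiduallyTranscendental V W} :=
    fun B => ⟨(monomialRing U (cen B) (rad B)).comap (ratFuncMap K Kbar),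
      isResiduallyTranscendental_monomialRing hU _ _⟩
  have hf : ∀ α ρ, (f (mkBall U α ρ) : ValuationSubring (RatFunc K)) =
      (monomialRing U α ρ).comap (ratFuncMap K Kbar) := fun α ρ => by
    change (monomialRing U _ _).comap _ = _
    rw [monomialRing_eq_iff.mpr (congrArg Subtype.val (hcr (mkBall U α ρ))).symm]
  -- One direction makes `Θ` well defined on orbits, the other makes it injective.
  have hrel : ∀ B B' : balls K U, f B = f B' ↔
      MulAction.orbitRel (U.decompositionSubgroup K) _ B B' := by
    intro B B'
    obtain ⟨α, ρ, rfl⟩ := (⟨_, _, hcr B⟩ : ∃ α ρ, B = mkBall U α ρ)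
    obtain ⟨β, τ, rfl⟩ := (⟨_, _, hcr B'⟩ : ∃ α ρ, B' = mkBall U α ρ)
    rw [MulAction.orbitRel_apply, MulAction.mem_orbit_iff, Subtype.ext_iff, hf, hf]
    constructor
    · intro h
      obtain ⟨σ, hσ⟩ := exists_coeffAction_mem_iff h.symm
      -- Both monomial rings meet the constants in `U`, so `σ` lies in the decomposition group.
      have hσU : ∀ x, σ x ∈ U ↔ x ∈ U := fun x => by
        have hx := hσ (RatFunc.C x)
        rwa [coeffAction_C, ← ValuationSubring.mem_comap, ← ValuationSubring.mem_comap,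
          monomialRing_comap_C, monomialRing_comap_C] at hx
      obtain ⟨τ', hτ', hmem⟩ := hsmul σ hσU β τ
      refine ⟨⟨σ, mem_decompositionSubgroup_iff.mpr hσU⟩, Subtype.ext ?_⟩
      change σ • ball U β τ = ball U α ρ
      rw [hτ', ← monomialRing_eq_iff]
      ext y
      rw [← coeffAction_apply_inv σ y, hmem, hσ]
    · rintro ⟨σ, hσ⟩
      have hσU := mem_decompositionSubgroup_iff.mp σ.2
      have hσ' : (σ : Kbar ≃ₐ[K] Kbar) • ball U β τ = ball U α ρ := congrArg Subtype.val hσ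
      obtain ⟨τ', hτ', hmem⟩ := hsmul σ hσU β τ
      rw [hτ'] at hσ'
      ext y
      rw [← monomialRing_eq_iff.mpr hσ', ValuationSubring.mem_comap, ValuationSubring.mem_comap,
        ← hmem, coeffAction_ratFuncMap]
  refine ⟨Quotient.lift f fun B B' h => (hrel B B').mpr h, hf, ?_, ?_⟩
  · intro q q'
    induction q using Quotient.inductionOn with | h B =>
    induction q' using Quotient.inductionOn with | h B' =>
    exact fun h => Quotient.sound ((hrel B B').mp h)
  · rintro ⟨W, hW⟩
    obtain ⟨α, ρ, hρ, rfl⟩ := exists_eq_comap_monomialRing hU hW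
    exact ⟨Quotient.mk _ (mkBall U α ⟨ρ, hρ⟩), Subtype.ext (hf α ⟨ρ, hρ⟩)⟩
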